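/- Let $(\Omega,\mathcal E,\mathbb P)$ be a probability space and $\mathcal F\subset\mathcal E$ a sub-$\sigma$-algebra; random variables that agree almost surely are identified, and (in)equalities between them hold almost surely. $L^0(\mathcal F)$ is the space of real $\mathcal F$-measurable random variables and $L^0_{++}(\mathcal F)$ the set of its almost surely strictly positive elements. A Young function is an increasing, left-continuous, convex function $\varphi:[0,\infty)\to[0,\infty]$, finite on a neighbourhood of $0$, with $\varphi(0)=0$ and $\lim_{t\to\infty}\varphi(t)=\infty$; its conjugate is $\varphi^*(s)=\sup_{t\ge 0}(ts-\varphi(t))$. For a $\sigma$-algebra $\mathcal G\subset\mathcal E$ let $L^\varphi(\mathcal G)$ be the set of $\mathcal G$-measurable $x$ with $\mathbb E[\varphi(|x|/c)]<\infty$ for some real $c>0$, and let $$L^\varphi_{\mathcal F}(\mathcal E)=\{x\in L^0(\mathcal E)\;:\;\mathbb E[\varphi(|x|\lambda^{-1})\,|\,\mathcal F]<\infty \text{ a.s. for some } \lambda\in L^0_{++}(\mathcal F)\}.$$ Every $x\in L^\varphi_{\mathcal F}(\mathcal E)$ has the form $x=\sum_k 1_{A_k}x_k$ with $\{A_k\}_{k\in\mathbb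 N}$ a countable $\mathcal F$-measurable partition of $\Omega$ and $x_k\in L^\varphi(\mathcal E)$. The conditional expectation is extended from $L^1(\mathcal E)$ to sums $x=\sum_k1_{A_k}x_k$ of this kind with $x_k\in L^1(\mathcal E)$ by $\mathbb E[x|\mathcal F]=\sum_k1_{A_k}\mathbb E[x_k|\mathcal F]$. Let $\varphi,\psi$ be Young functions with $\psi\le\varphi$ and let $\rho:L^\varphi(\mathcal E)\to L^\psi(\mathcal F)$ be a conditional convex risk measure, that is, for all $x,y\in L^\varphi(\mathcal E)$: $x\le y$ implies $\rho(x)\ge\rho(y)$; $\rho(\lambda x+(1-\lambda)y)\le\lambda\rho(x)+(1-\lambda)\rho(y)$ for all $\lambda\in L^0(\mathcal F)$ with $0\le\lambda\le1$; and $\rho(x+\lambda)=\rho(x)-\lambda$ for all $\lambda\in L^\varphi(\mathcal F)$. Let $\bar\rho:L^\varphi_{\mathcal F}(\mathcal E)\to L^0(\mathcal F)$ be its stable extension, $\bar\rho(\sum_k1_{A_k}x_k)=\sum_k1_{A_k}\rho(x_k)$ for $x_k\in L^\varphi(\mathcal E)$ and $\mathcal F$-measurable partitions $\{A_k\}$.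 Put $$\rho^*(y)=\operatorname{ess\,sup}\{\mathbb E[xy|\mathcal F]-\rho(x): x\in L^\varphi(\mathcal E)\}\ \text{ for } y\in L^{\varphi^*}(\mathcal E),$$ $$\bar\rho^*(y)=\operatorname{ess\,sup}\{\mathbb E[xy|\mathcal F]-\bar\rho(x): x\in L^\varphi_{\mathcal F}(\mathcal E)\}\ \text{ for } y\in L^{\varphi^*}_{\mathcal F}(\mathcal E).$$ Let $\sigma(L^\varphi_{\mathcal F}(\mathcal E),L^{\varphi^*}_{\mathcal F}(\mathcal E))$ be the topology on $L^\varphi_{\mathcal F}(\mathcal E)$ in which the sets $\{z: |\mathbb E[(z-x)q|\mathcal F]|\le\varepsilon\ \text{for all } q\in Q\}$, with $Q\subset L^{\varphi^*}_{\mathcal F}(\mathcal E)$ finite and $\varepsilon\in L^0_{++}(\mathcal F)$, form a neighbourhood base at each $x$; $\bar\rho$ is called lower semicontinuous for it if $\{x:\bar\rho(x)\le c\}$ is closed for every $c\in L^0(\mathcal F)$. Then the following are equivalent: 1. $\bar\rho$ is $\sigma(L^\varphi_{\mathcal F}(\mathcal E),L^{\varphi^*}_{\mathcal F}(\mathcal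 E))$-lower semicontinuous; 2. for every $x\in L^\varphi_{\mathcal F}(\mathcal E)$, $$\bar\rho(x)=\operatorname{ess\,sup}\{\mathbb E[xy|\mathcal F]-\bar\rho^*(y)\;:\;y\in L^{\varphi^*}_{\mathcal F}(\mathcal E),\ \mathbb E[y|\mathcal F]=-1,\ y\le0\};$$ 3. for every $x\in L^\varphi(\mathcal E)$, $$\rho(x)=\operatorname{ess\,sup}\{\mathbb E[xy|\mathcal F]-\rho^*(y)\;:\;y\in L^{\varphi^*}(\mathcal E),\ \mathbb E[y|\mathcal F]=-1,\ y\le0\}.$$ -/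

import Mathlib

open MeasureTheory Set Filter Topology
open scoped NNReal ENNReal

noncomputable section

namespace CondRisk

/-- Young functions `[0,∞) → [0,∞]`: increasing, left-continuous, convex, finite on a neighbourhood
of `0`, vanishing at `0`, and tending to `∞` at `∞`. -/
structure IsYoung (φ : ℝ≥0 → ℝ≥0∞) : Prop where
  mono : Monotone φ
  leftCont : ∀ t, ContinuousWithinAt φ (Iic t) t
  convex : ConvexOn ℝ≥0 univ φ
  finite_near_zero : ∀ᶠ t in 𝓝 (0 : ℝ≥0), φ t < ∞
  map_zero : φ 0 = 0
  tendsto_top : Tendsto φ atTop (𝓝 ∞)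

/-- The conjugate `φ*(s) = sup_{t ≥ 0} (t s - φ(t))`. The truncated subtraction of `[0,∞]` does not
change the supremum, since `t = 0` contributes `-φ(0) = 0`. -/
def conj (φ : ℝ≥0 → ℝ≥0∞) (s : ℝ≥0) : ℝ≥0∞ := ⨆ t : ℝ≥0, ((t : ℝ≥0∞) * s - φ t)

section Spaces

variable {Ω : Type*} (m : MeasurableSpace Ω) {m0 : MeasurableSpace Ω} (μ : Measure[m0] Ω)

/-- `L⁰(𝓕)`, as the set of those classes in `L⁰(𝓔)` which have an `m`-measurable representative. -/
def L0 : Set (Ω →ₘ[μ] ℝ) := {x | AEStronglyMeasurable[m] x μ}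

/-- `L⁰₊₊(𝓕)`: the elements of `L⁰(𝓕)` that are strictly positive almost surely. -/
def L0pp : Set (Ω →ₘ[μ] ℝ) := {x | x ∈ L0 m μ ∧ ∀ᵐ ω ∂μ, 0 < x ω}

/-- The Orlicz space over the σ-algebra `m`: the `m`-measurable `x` with
`E[φ(|x| / c)] < ∞` for some real `c > 0`. -/
def orlicz (φ : ℝ≥0 → ℝ≥0∞) : Set (Ω →ₘ[μ] ℝ) :=
  {x | x ∈ L0 m μ ∧ ∃ c : ℝ≥0, 0 < c ∧ ∫⁻ ω, φ (‖x ω‖₊ / c) ∂μ < ∞}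

/-- The Orlicz-type module `L^φ_𝓕(𝓔)`: the `x ∈ L⁰(𝓔)` with
`E[φ(|x| / l) | 𝓕] < ∞` almost surely for some `l ∈ L⁰₊₊(𝓕)`. -/
def orliczModule (φ : ℝ≥0 → ℝ≥0∞) : Set (Ω →ₘ[μ] ℝ) :=
  {x | ∃ l ∈ L0pp m μ, ∀ᵐ ω ∂μ, condLExp m μ (fun ω => φ (‖x ω‖₊ / ‖l ω‖₊)) ω < ∞}

/-- Countable partitions of `Ω` into `m`-measurable sets (possibly empty). -/
def IsPartition (A : ℕ → Set Ω) : Prop :=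
  (∀ k, MeasurableSet[m] (A k)) ∧ Pairwise (fun i j => Disjoint (A i) (A j)) ∧ ⋃ k, A k = univ

variable {μ} in
/-- `x = ∑ₖ 1_{A k} xs k`. -/
def IsConcat (A : ℕ → Set Ω) (xs : ℕ → (Ω →ₘ[μ] ℝ)) (x : Ω →ₘ[μ] ℝ) : Prop :=
  ∀ k, ∀ᵐ ω ∂μ, ω ∈ A k → x ω = xs k ω

variable {μ} in
/-- The stable extension of `f : D → L⁰` to the countable concatenation hull of `D`:
`f̄(∑ₖ 1_{A k} xₖ) = ∑ₖ 1_{A k} f(xₖ)` for `xₖ ∈ D`. (For the `f` considered below the right-hand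
side does not depend on the chosen way of writing the argument.) -/
def stableExt (D : Set (Ω →ₘ[μ] ℝ)) (f : (Ω →ₘ[μ] ℝ) → (Ω →ₘ[μ] ℝ)) (x : Ω →ₘ[μ] ℝ) :
    Ω →ₘ[μ] ℝ :=
  Classical.epsilon fun z => ∃ (A : ℕ → Set Ω) (xs : ℕ → (Ω →ₘ[μ] ℝ)),
    IsPartition m A ∧ (∀ k, xs k ∈ D) ∧ IsConcat A xs x ∧ IsConcat A (fun k => f (xs k)) z

/-- The classical conditional expectation `L¹(𝓔) → L¹(𝓕)` as a map between classes. -/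
def condE (x : Ω →ₘ[μ] ℝ) : Ω →ₘ[μ] ℝ :=
  AEEqFun.mk (condExp m μ x) integrable_condExp.aestronglyMeasurable

/-- The conditional expectation extended from `L¹(𝓔)` to `L¹_𝓕(𝓔)`, its concatenation hull. -/
def condEExt (x : Ω →ₘ[μ] ℝ) : Ω →ₘ[μ] ℝ :=
  stableExt m {z : Ω →ₘ[μ] ℝ | Integrable z μ} (condE m μ) x

end Spaces

section EssSup

variable {Ω : Type*} {m0 : MeasurableSpace Ω} {μ : Measure[m0] Ω}

/-- The inclusion of `L⁰` into the classes of extended real valued random variables. -/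
def toE (x : Ω →ₘ[μ] ℝ) : Ω →ₘ[μ] EReal := AEEqFun.comp Real.toEReal continuous_coe_real_ereal x

theorem measurable_ereal_sub :
    Measurable (Function.uncurry (fun a b : EReal => a - b)) := by
  have : Function.uncurry (fun a b : EReal => a - b) = fun p => p.1 + -p.2 := by
    ext p; simp [Function.uncurry, sub_eq_add_neg]
  rw [this]
  exact measurable_fst.add ((continuous_neg (G := EReal)).measurable.comp measurable_snd)

/-- `x - g` for `x ∈ L⁰` and an extended real valued `g`. -/
def subE (x : Ω →ₘ[μ] ℝ) (g : Ω →ₘ[μ] EReal) : Ω →ₘ[μ] EReal :=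
  AEEqFun.comp₂Measurable (fun a b : EReal => a - b) measurable_ereal_sub (toE x) g

/-- The essential supremum of a family of (classes of) extended real valued random variables: its
least upper bound for the almost sure order, which exists by `isLUB_esssup`. -/
def esssup (C : Set (Ω →ₘ[μ] EReal)) : Ω →ₘ[μ] EReal := Classical.epsilon fun g => IsLUB C g

theorem exists_isLUB [IsFiniteMeasure μ] (C : Set (Ω →ₘ[μ] EReal)) : ∃ g, IsLUB C g := by
  rcases C.eq_empty_or_nonempty with rfl | hC
  · refine ⟨AEEqFun.const Ω ⊥, by simp, fun b _ => ?_⟩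
    rw [← AEEqFun.coeFn_le]
    filter_upwards [AEEqFun.coeFn_const (μ := μ) Ω (⊥ : EReal)] with ω hω
    rw [hω]; exact bot_le
  have : Nonempty C := hC.to_subtype
  let e : EReal ≃o Icc (0 : ℝ) 1 := EReal.expOrderIso.trans ENNReal.orderIsoUnitIntervalBirational
  let H : EReal → ℝ≥0∞ := fun t => ENNReal.ofReal (e t : ℝ)
  have Hmono : Monotone H := fun a b h => ENNReal.ofReal_le_ofReal (e.monotone h)
  have Hinj : Function.Injective H := by
    intro a b h
    have h' : (e a : ℝ) = e b := (ENNReal.ofReal_eq_ofReal_iff (e a).2.1 (e b).2.1).1 h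
    exact e.injective (Subtype.ext h')
  have Hle : ∀ t, H t ≤ 1 := fun t => by
    simpa [H] using ENNReal.ofReal_le_ofReal (e t).2.2
  let S : (ℕ → C) → Ω → EReal := fun s ω => ⨆ n, (s n : Ω →ₘ[μ] EReal) ω
  have Smeas : ∀ s, Measurable (S s) := fun s => Measurable.iSup fun n => (s n).1.measurable
  let F : (ℕ → C) → ℝ≥0∞ := fun s => ∫⁻ ω, H (S s ω) ∂μ
  have Ffin : ∀ s, F s ≠ ∞ := fun s => by
    refine ne_top_of_le_ne_top (measure_ne_top μ univ) ?_
    calc F s ≤ ∫⁻ _, 1 ∂μ := lintegral_mono fun ω => Hle _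
      _ = μ univ := by simp
  obtain ⟨u, -, hu, hmem⟩ := exists_seq_tendsto_sSup (range_nonempty F) (OrderTop.bddAbove _)
  choose s hs using hmem
  let t : ℕ → C := fun n => s n.unpair.1 n.unpair.2
  have hst : ∀ k ω, S (s k) ω ≤ S t ω := fun k ω => iSup_le fun n => by
    simpa [t] using le_iSup (fun j => (t j : Ω →ₘ[μ] EReal) ω) (Nat.pair k n)
  have hFt : sSup (range F) ≤ F t := by
    refine le_of_tendsto' hu fun k => ?_
    rw [← hs k]
    exact lintegral_mono fun ω => Hmono (hst k ω)
  have hcoe : (AEEqFun.mk (S t) (Smeas t).aestronglyMeasurable : Ω →ₘ[μ] EReal) =ᵐ[μ] S t :=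
    AEEqFun.coeFn_mk _ _
  refine ⟨AEEqFun.mk (S t) (Smeas t).aestronglyMeasurable, fun f hf => ?_, fun b hb => ?_⟩
  · let t' : ℕ → C := fun n => Nat.casesOn n ⟨f, hf⟩ t
    have h1 : ∀ ω, S t ω ≤ S t' ω := fun ω => iSup_le fun n => by
      have := le_iSup (fun j => ((t' j).1 : Ω →ₘ[μ] EReal) ω) (n + 1)
      exact this
    have h2 : F t' ≤ F t := (le_sSup (mem_range_self t')).trans hFt
    have h3 := ae_eq_of_ae_le_of_lintegral_le (ae_of_all μ fun ω => Hmono (h1 ω)) (Ffin t)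
      (Hmono.measurable.comp (Smeas t')).aemeasurable h2
    rw [← AEEqFun.coeFn_le]
    filter_upwards [h3, hcoe] with ω hω hc
    rw [hc, Hinj hω]
    have := le_iSup (fun j => ((t' j).1 : Ω →ₘ[μ] EReal) ω) 0
    exact this
  · rw [← AEEqFun.coeFn_le]
    have : ∀ᵐ ω ∂μ, ∀ n, (t n : Ω →ₘ[μ] EReal) ω ≤ b ω :=
      ae_all_iff.2 fun n => AEEqFun.coeFn_le.2 (hb (t n).2)
    filter_upwards [this, hcoe] with ω hω hc
    rw [hc]
    exact iSup_le hω

theorem isLUB_esssup [IsFiniteMeasure μ] (C : Set (Ω →ₘ[μ] EReal)) : IsLUB C (esssup C) :=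
  Classical.epsilon_spec (exists_isLUB C)

end EssSup

section Risk

variable {Ω : Type*} (m : MeasurableSpace Ω) {m0 : MeasurableSpace Ω} (μ : Measure[m0] Ω)

/-- Conditional convex risk measures `ρ : L^φ(𝓔) → L^ψ(𝓕)`; only the values of `ρ` on `L^φ(𝓔)`
matter. -/
structure IsCondConvexRiskMeasure (φ ψ : ℝ≥0 → ℝ≥0∞) (ρ : (Ω →ₘ[μ] ℝ) → (Ω →ₘ[μ] ℝ)) :
    Prop where
  mapsTo : MapsTo ρ (orlicz m0 μ φ) (orlicz m μ ψ)
  antitone : ∀ x ∈ orlicz m0 μ φ, ∀ y ∈ orlicz m0 μ φ, x ≤ y → ρ y ≤ ρ x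
  convex : ∀ x ∈ orlicz m0 μ φ, ∀ y ∈ orlicz m0 μ φ, ∀ l ∈ L0 m μ, 0 ≤ l → l ≤ 1 →
    ρ (l * x + (1 - l) * y) ≤ l * ρ x + (1 - l) * ρ y
  cash : ∀ x ∈ orlicz m0 μ φ, ∀ l ∈ orlicz m μ φ, ρ (x + l) = ρ x - l

variable {μ} in
/-- `ρ̄`, the stable extension of `ρ` from `L^φ(𝓔)` to `L^φ_𝓕(𝓔)`. -/
def extension (φ : ℝ≥0 → ℝ≥0∞) (ρ : (Ω →ₘ[μ] ℝ) → (Ω →ₘ[μ] ℝ)) : (Ω →ₘ[μ] ℝ) → (Ω →ₘ[μ] ℝ) :=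
  stableExt m (orlicz m0 μ φ) ρ

variable {μ} in
/-- `ρ*(y) = esssup {E[xy | 𝓕] - ρ(x) ; x ∈ L^φ(𝓔)}`. -/
def fenchel (φ : ℝ≥0 → ℝ≥0∞) (ρ : (Ω →ₘ[μ] ℝ) → (Ω →ₘ[μ] ℝ)) (y : Ω →ₘ[μ] ℝ) : Ω →ₘ[μ] EReal :=
  esssup {g | ∃ x ∈ orlicz m0 μ φ, g = toE (condE m μ (x * y) - ρ x)}

variable {μ} in
/-- The modular conjugate `f*(y) = esssup {E[xy | 𝓕] - f(x) ; x ∈ L^φ_𝓕(𝓔)}`. -/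
def fenchelModule (φ : ℝ≥0 → ℝ≥0∞) (f : (Ω →ₘ[μ] ℝ) → (Ω →ₘ[μ] ℝ)) (y : Ω →ₘ[μ] ℝ) :
    Ω →ₘ[μ] EReal :=
  esssup {g | ∃ x ∈ orliczModule m μ φ, g = toE (condEExt m μ (x * y) - f x)}

variable {m μ} in
theorem inf_mem_L0pp {e e' : Ω →ₘ[μ] ℝ} (he : e ∈ L0pp m μ) (he' : e' ∈ L0pp m μ) :
    e ⊓ e' ∈ L0pp m μ := by
  obtain ⟨g, hg, h⟩ := he.1
  obtain ⟨g', hg', h'⟩ := he'.1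
  refine ⟨⟨g ⊓ g', @StronglyMeasurable.inf _ _ _ _ m _ _ _ hg hg', (AEEqFun.coeFn_inf e e').trans ?_⟩, ?_⟩
  · filter_upwards [h, h'] with ω h1 h2
    simp [h1, h2]
  filter_upwards [AEEqFun.coeFn_inf e e', he.2, he'.2] with ω h h1 h2
  rw [h]
  exact lt_min h1 h2

/-- The weak topology `σ(E, G)` on `E` for the pairing `⟨x, y⟩ = E[xy | 𝓕]`: the sets
`x + U_{Q,ε}`, where `U_{Q,ε} = {u ; |⟨u, q⟩| ≤ ε for all q ∈ Q}` with `Q ⊆ G` finite and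
`ε ∈ L⁰₊₊(𝓕)`, form a neighbourhood base at `x`. -/
@[reducible]
def weakTopology (E G : Set (Ω →ₘ[μ] ℝ)) : TopologicalSpace E where
  IsOpen O := ∀ x ∈ O, ∃ Q : Finset (Ω →ₘ[μ] ℝ), ↑Q ⊆ G ∧ ∃ e ∈ L0pp m μ,
    ∀ z : E, (∀ q ∈ Q, ∀ᵐ ω ∂μ, |condEExt m μ ((z.1 - x.1) * q) ω| ≤ e ω) → z ∈ O
  isOpen_univ := fun _ _ => ⟨∅, by simp, 1,
    ⟨(aestronglyMeasurable_const (b := (1 : ℝ))).congr AEEqFun.coeFn_one.symm, by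
      filter_upwards [AEEqFun.coeFn_one (β := ℝ) (μ := μ)] with ω h
      rw [h]; exact one_pos⟩, fun _ _ => mem_univ _⟩
  isOpen_inter := by
    classical
    rintro s t hs ht x ⟨hxs, hxt⟩
    obtain ⟨Q, hQ, e, he, h⟩ := hs x hxs
    obtain ⟨Q', hQ', e', he', h'⟩ := ht x hxt
    refine ⟨Q ∪ Q', by simp [hQ, hQ'], e ⊓ e', inf_mem_L0pp he he', fun z hz => ⟨h z ?_, h' z ?_⟩⟩
    · intro q hq
      filter_upwards [hz q (by simp [hq]), AEEqFun.coeFn_inf e e'] with ω h1 h2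
      rw [h2] at h1
      exact h1.trans inf_le_left
    · intro q hq
      filter_upwards [hz q (by simp [hq]), AEEqFun.coeFn_inf e e'] with ω h1 h2
      rw [h2] at h1
      exact h1.trans inf_le_right
  isOpen_sUnion := by
    rintro S hS x ⟨s, hs, hx⟩
    obtain ⟨Q, hQ, e, he, h⟩ := hS s hs x hx
    exact ⟨Q, hQ, e, he, fun z hz => ⟨s, hs, h z hz⟩⟩

/-- `σ(E, G)`-lower semicontinuity of an `L⁰(𝓕)`-valued function `f` on `E`: for every
`c ∈ L⁰(𝓕)` the sublevel set `{x ∈ E ; f(x) ≤ c}` is `σ(E, G)`-closed. -/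
def WeakLSC (E G : Set (Ω →ₘ[μ] ℝ)) (f : (Ω →ₘ[μ] ℝ) → (Ω →ₘ[μ] ℝ)) : Prop :=
  ∀ c ∈ L0 m μ, IsClosed[weakTopology m μ E G] {x : E | f x ≤ c}

end Risk

end CondRisk

end

noncomputable section

/-! The implications run 1 ⇒ 3 ⇒ 2 ⇒ 1. The first is a conditional Hahn–Banach argument; the other
two rest on locality and the Fenchel–Young inequality.

Convexity with indicator weights makes `ρ` local (`IsCondConvexRiskMeasure.isLocalOn`). Hence the
stable extension does not depend on the chosen decomposition, and statements can be proved on small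
pieces of positive measure and then spread by exhaustion (`exists_seq_measure_diff_eq_zero`).

1 ⇒ 3. Fix a level `c < ρ(x₀)`. Lying outside a weak neighbourhood means only that the defining
bound fails on some nonnull set; exhaustion and gluing strengthen this to failure almost everywhere
on one nonnull set `D`, uniformly over the sublevel set (`exists_neighbourhood_avoiding_sublevel`).
Only finitely many dual elements `q p` enter, so the pairings of `z - x₀` form a random vector in a
Euclidean space. These vectors form a convex family, stable under gluing and bounded away from `0`
on `D`; a limit of norm-minimising elements separates it from `0`
(`exists_stronglyMeasurable_inner_pos`), and its coordinates are the coefficients of one separating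
dual element (`exists_separating_dual`). Monotonicity of `ρ` gives this element its sign,
normalising makes it feasible, and cash invariance turns separation from the sublevel set into the
bound `E[x₀η | 𝓕] - c` for the conjugate at the normalised element `η`
(`exists_feasible_dual_of_separating`). Exhausting `Ω` and letting `c` increase to `ρ(x₀)` gives the
nontrivial inequality.

3 ⇒ 2. On each piece of a decomposition of `x` the representation of `ρ` applies, its dual elements
are feasible in the module, and passing to the modular conjugate does not increase the penalty
(`extension_representation`).

2 ⇒ 1. If `ρ̄(x) ≤ c` fails, one dual element already exceeds `c` on a nonnull `𝓕`-measurable set,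
and half the gap is the radius of a neighbourhood missing the sublevel set
(`weakLSC_of_extension_representation`). -/

namespace CondRisk

/-! ### Exhaustion: essential suprema and essential unions along sequences. -/

section Exhaustion

variable {Ω : Type*} {m m0 : MeasurableSpace Ω} {μ : Measure[m0] Ω}

/-- A nonempty family of extended real random variables is dominated by the supremum of one of its
sequences. -/
theorem exists_seq_forall_ae_le_iSup [IsFiniteMeasure μ] {C : Set (Ω →ₘ[μ] EReal)}
    (hC : C.Nonempty) :
    ∃ t : ℕ → C, ∀ f ∈ C, ∀ᵐ ω ∂μ, f ω ≤ ⨆ n, (t n : Ω →ₘ[μ] EReal) ω := by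
  have : Nonempty C := hC.to_subtype
  -- An order isomorphism onto `[0,1]` makes every integral finite without losing strict
  -- inequalities, so suprema can be compared through their integrals.
  let e : EReal ≃o Icc (0 : ℝ) 1 := EReal.expOrderIso.trans ENNReal.orderIsoUnitIntervalBirational
  let H : EReal → ℝ≥0∞ := fun t => ENNReal.ofReal (e t : ℝ)
  have Hmono : Monotone H := fun a b h => ENNReal.ofReal_le_ofReal (e.monotone h)
  have Hinj : Function.Injective H := by
    intro a b h
    have h' : (e a : ℝ) = e b := (ENNReal.ofReal_eq_ofReal_iff (e a).2.1 (e b).2.1).1 h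
    exact e.injective (Subtype.ext h')
  have Hle : ∀ t, H t ≤ 1 := fun t => by
    simpa [H] using ENNReal.ofReal_le_ofReal (e t).2.2
  let S : (ℕ → C) → Ω → EReal := fun s ω => ⨆ n, (s n : Ω →ₘ[μ] EReal) ω
  have Smeas : ∀ s, Measurable (S s) := fun s => Measurable.iSup fun n => (s n).1.measurable
  let F : (ℕ → C) → ℝ≥0∞ := fun s => ∫⁻ ω, H (S s ω) ∂μ
  have Ffin : ∀ s, F s ≠ ∞ := fun s => by
    refine ne_top_of_le_ne_top (measure_ne_top μ univ) ?_
    calc F s ≤ ∫⁻ _, 1 ∂μ := lintegral_mono fun ω => Hle _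
      _ = μ univ := by simp
  -- Sequences whose integrals approach the supremum are interleaved into one sequence `t`, which
  -- therefore attains it.
  obtain ⟨u, -, hu, hmem⟩ := exists_seq_tendsto_sSup (range_nonempty F) (OrderTop.bddAbove _)
  choose s hs using hmem
  let t : ℕ → C := fun n => s n.unpair.1 n.unpair.2
  have hst : ∀ k ω, S (s k) ω ≤ S t ω := fun k ω => iSup_le fun n => by
    simpa [t] using le_iSup (fun j => (t j : Ω →ₘ[μ] EReal) ω) (Nat.pair k n)
  have hFt : sSup (range F) ≤ F t := by
    refine le_of_tendsto' hu fun k => ?_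
    rw [← hs k]
    exact lintegral_mono fun ω => Hmono (hst k ω)
  refine ⟨t, fun f hf => ?_⟩
  -- Prepending `f` to the maximising sequence cannot raise the integral, so it does not change the
  -- pointwise supremum almost everywhere.
  let t' : ℕ → C := fun n => Nat.casesOn n ⟨f, hf⟩ t
  have h1 : ∀ ω, S t ω ≤ S t' ω := fun ω => iSup_le fun n => by
    have := le_iSup (fun j => ((t' j).1 : Ω →ₘ[μ] EReal) ω) (n + 1)
    exact this
  have h2 : F t' ≤ F t := (le_sSup (mem_range_self t')).trans hFt
  have h3 := ae_eq_of_ae_le_of_lintegral_le (ae_of_all μ fun ω => Hmono (h1 ω)) (Ffin t)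
    (Hmono.measurable.comp (Smeas t')).aemeasurable h2
  filter_upwards [h3] with ω hω
  have := le_iSup (fun j => ((t' j).1 : Ω →ₘ[μ] EReal) ω) 0
  change f ω ≤ S t ω
  rw [Hinj hω]
  exact this

/-- The essential supremum is attained along a sequence. -/
theorem exists_seq_esssup [IsFiniteMeasure μ] {C : Set (Ω →ₘ[μ] EReal)} (hC : C.Nonempty) :
    ∃ t : ℕ → C, ∀ᵐ ω ∂μ, esssup C ω = ⨆ n, (t n : Ω →ₘ[μ] EReal) ω := by
  obtain ⟨t, ht⟩ := exists_seq_forall_ae_le_iSup hC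
  refine ⟨t, ?_⟩
  have hm : Measurable fun ω => ⨆ n, (t n : Ω →ₘ[μ] EReal) ω :=
    Measurable.iSup fun n => (t n).1.measurable
  have hcoe := AEEqFun.coeFn_mk (μ := μ) _ hm.aestronglyMeasurable
  have h1 : esssup C ≤ AEEqFun.mk _ hm.aestronglyMeasurable := by
    refine (isLUB_esssup C).2 fun f hf => ?_
    rw [← AEEqFun.coeFn_le]
    filter_upwards [ht f hf, hcoe] with ω h h'
    rwa [h']
  have h2 : ∀ᵐ ω ∂μ, ∀ n, (t n : Ω →ₘ[μ] EReal) ω ≤ esssup C ω :=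
    ae_all_iff.2 fun n => AEEqFun.coeFn_le.2 ((isLUB_esssup C).1 (t n).2)
  filter_upwards [AEEqFun.coeFn_le.2 h1, h2, hcoe] with ω h h' h''
  exact le_antisymm (h'' ▸ h) (iSup_le h')

/-- A nonempty family of measurable sets is essentially covered by one of its sequences. -/
theorem exists_seq_measure_diff_eq_zero [IsFiniteMeasure μ] {S : Set (Set Ω)} (hS : S.Nonempty)
    (hmeas : ∀ A ∈ S, MeasurableSet A) :
    ∃ A : ℕ → Set Ω, (∀ n, A n ∈ S) ∧ ∀ B ∈ S, μ (B \ ⋃ n, A n) = 0 := by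
  let f : S → (Ω →ₘ[μ] EReal) := fun A =>
    AEEqFun.mk (A.1.indicator 1) (measurable_one.indicator (hmeas A A.2)).aestronglyMeasurable
  have hf : ∀ A, f A =ᵐ[μ] A.1.indicator 1 := fun A => AEEqFun.coeFn_mk _ _
  have : Nonempty S := hS.to_subtype
  obtain ⟨t, ht⟩ := exists_seq_forall_ae_le_iSup (range_nonempty f)
  choose A hA using fun n => (t n).2
  refine ⟨fun n => A n, fun n => (A n).2, fun B hB => ?_⟩
  have h : ∀ᵐ ω ∂μ, ω ∉ B \ ⋃ n, (A n : Set Ω) := by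
    filter_upwards [ht _ ⟨⟨B, hB⟩, rfl⟩, hf ⟨B, hB⟩, ae_all_iff.2 fun n => hf (A n)] with ω h1 h2 h3
    rintro ⟨hωB, hω⟩
    rw [h2, indicator_of_mem hωB] at h1
    have : ⨆ n, (t n : Ω →ₘ[μ] EReal) ω ≤ 0 := iSup_le fun n => by
      rw [← hA n, h3 n, indicator_of_notMem fun h => hω (mem_iUnion.2 ⟨n, h⟩)]
    exact absurd (h1.trans this) (by simp)
  exact measure_eq_zero_iff_ae_notMem.2 h

end Exhaustion

/-! ### Gluing of random variables along measurable sets. -/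

section Gluing

variable {Ω : Type*} {m m0 : MeasurableSpace Ω} {μ : Measure[m0] Ω}

theorem mem_L0_of_ae_eq {f : Ω → ℝ} (hf : StronglyMeasurable[m] f) {x : Ω →ₘ[μ] ℝ}
    (h : x =ᵐ[μ] f) : x ∈ L0 m μ := ⟨f, hf, h⟩

theorem mem_L0_top (x : Ω →ₘ[μ] ℝ) : x ∈ L0 m0 μ := x.aestronglyMeasurable

theorem exists_class_of_stronglyMeasurable (hm : m ≤ m0) {f : Ω → ℝ}
    (hf : StronglyMeasurable[m] f) : ∃ x : Ω →ₘ[μ] ℝ, x ∈ L0 m μ ∧ x =ᵐ[μ] f :=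
  ⟨AEEqFun.mk f (hf.mono hm).aestronglyMeasurable,
    mem_L0_of_ae_eq hf (AEEqFun.coeFn_mk _ _), AEEqFun.coeFn_mk _ _⟩

theorem exists_concat {A : ℕ → Set Ω} (hA : ∀ k, MeasurableSet (A k))
    (hd : Pairwise fun i j => Disjoint (A i) (A j)) (xs : ℕ → (Ω →ₘ[μ] ℝ)) :
    ∃ z : Ω →ₘ[μ] ℝ, IsConcat A xs z := by
  obtain ⟨f, hf, h⟩ := exists_measurable_piecewise A hA (fun k => xs k)
    (fun k => (xs k).measurable) (fun i j hij ω hω => absurd hω.2 (disjoint_left.1 (hd hij) hω.1))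
  refine ⟨AEEqFun.mk f hf.aestronglyMeasurable, fun k => ?_⟩
  filter_upwards [AEEqFun.coeFn_mk f hf.aestronglyMeasurable] with ω hω hωA
  rw [hω, h k hωA]

theorem exists_glue {A : Set Ω} (hA : MeasurableSet A) (x y : Ω →ₘ[μ] ℝ) :
    ∃ z : Ω →ₘ[μ] ℝ, ∀ᵐ ω ∂μ, (ω ∈ A → z ω = x ω) ∧ (ω ∉ A → z ω = y ω) := by
  classical
  have hf : Measurable (A.piecewise x y) := x.measurable.piecewise hA y.measurable
  refine ⟨AEEqFun.mk _ hf.aestronglyMeasurable, ?_⟩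
  filter_upwards [AEEqFun.coeFn_mk _ hf.aestronglyMeasurable] with ω hω
  rw [hω]
  exact ⟨fun h => piecewise_eq_of_mem _ _ _ h, fun h => piecewise_eq_of_notMem _ _ _ h⟩

theorem mem_L0_of_concat {A : ℕ → Set Ω} (hA : IsPartition m A) {xs : ℕ → (Ω →ₘ[μ] ℝ)}
    (hxs : ∀ k, xs k ∈ L0 m μ) {z : Ω →ₘ[μ] ℝ} (hz : IsConcat A xs z) : z ∈ L0 m μ := by
  choose g hg hxg using hxs
  obtain ⟨f, hf, h⟩ := @exists_measurable_piecewise Ω ℝ m _ ℕ _ _ A hA.1 g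
    (fun k => (hg k).measurable)
    (fun i j hij ω hω => absurd hω.2 (disjoint_left.1 (hA.2.1 hij) hω.1))
  refine mem_L0_of_ae_eq (Measurable.stronglyMeasurable hf) ?_
  filter_upwards [ae_all_iff.2 hz, ae_all_iff.2 hxg] with ω h1 h2
  obtain ⟨k, hk⟩ := mem_iUnion.1 (hA.2.2 ▸ mem_univ ω)
  rw [h1 k hk, h2 k, h k hk]

theorem mem_L0_of_glue {A : Set Ω} (hA : MeasurableSet[m] A) {x y z : Ω →ₘ[μ] ℝ}
    (hx : x ∈ L0 m μ) (hy : y ∈ L0 m μ)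
    (hz : ∀ᵐ ω ∂μ, (ω ∈ A → z ω = x ω) ∧ (ω ∉ A → z ω = y ω)) : z ∈ L0 m μ := by
  classical
  obtain ⟨f, hf, hxf⟩ := hx
  obtain ⟨g, hg, hyg⟩ := hy
  refine mem_L0_of_ae_eq (f := A.piecewise f g) (StronglyMeasurable.piecewise hA hf hg) ?_
  filter_upwards [hz, hxf, hyg] with ω h h1 h2
  by_cases hω : ω ∈ A
  · rw [h.1 hω, h1, piecewise_eq_of_mem _ _ _ hω]
  · rw [h.2 hω, h2, piecewise_eq_of_notMem _ _ _ hω]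

/-- A set of positive measure covered by countably many `m`-measurable sets contains a piece of
positive measure in one of them. -/
theorem exists_measure_inter_pos {B : Set Ω} (hB : μ B ≠ 0) {A : ℕ → Set Ω}
    (hA : ∀ᵐ ω ∂μ, ω ∈ B → ∃ n, ω ∈ A n) : ∃ n, μ (B ∩ A n) ≠ 0 := by
  by_contra! h
  apply hB
  have h1 : μ (⋃ n, B ∩ A n) = 0 := measure_iUnion_null h
  refine le_antisymm (le_trans (measure_mono_ae ?_) h1.le) bot_le
  filter_upwards [hA] with ω hω hωB
  obtain ⟨n, hn⟩ := hω hωB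
  exact mem_iUnion.2 ⟨n, hωB, hn⟩

/-- An `m`-measurable random variable is bounded on a piece of positive measure of every set of
positive measure. -/
theorem exists_subset_bounded {B : Set Ω} (hBm : MeasurableSet[m] B) (hB : μ B ≠ 0) {f : Ω → ℝ}
    (hf : StronglyMeasurable[m] f) :
    ∃ D ⊆ B, MeasurableSet[m] D ∧ μ D ≠ 0 ∧ ∃ N : ℕ, ∀ ω ∈ D, |f ω| ≤ N := by
  obtain ⟨n, hn⟩ := exists_measure_inter_pos hB (A := fun n : ℕ => {ω | |f ω| ≤ n})
    (ae_of_all _ fun ω _ => exists_nat_ge |f ω|)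
  refine ⟨_, inter_subset_left, hBm.inter ?_, hn, n, fun ω hω => hω.2⟩
  exact (measurable_norm.comp hf.measurable) (measurableSet_Iic (a := (n : ℝ)))

end Gluing

/-! ### Young functions and their conjugates. -/

section Young

theorem conj_mono (φ : ℝ≥0 → ℝ≥0∞) : Monotone (conj φ) := fun a b hab =>
  iSup_mono fun t => by gcongr

theorem mul_le_add_conj (φ : ℝ≥0 → ℝ≥0∞) (t s : ℝ≥0) : (t : ℝ≥0∞) * s ≤ φ t + conj φ s := by
  rw [add_comm]
  exact tsub_le_iff_right.1 (le_iSup (fun t : ℝ≥0 => (t : ℝ≥0∞) * s - φ t) t)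

theorem IsYoung.exists_pos_lt_top {φ : ℝ≥0 → ℝ≥0∞} (hφ : IsYoung φ) : ∃ t, 0 < t ∧ φ t < ∞ := by
  obtain ⟨e, he, h⟩ := Metric.eventually_nhds_iff.1 hφ.finite_near_zero
  refine ⟨(e / 2).toNNReal, by simpa using he, h ?_⟩
  rw [NNReal.dist_eq, Real.coe_toNNReal _ (by positivity)]
  simp only [NNReal.coe_zero, sub_zero, abs_of_pos (half_pos he)]
  linarith

/-- Choose `r > 0` with `φ(r) > 1` and take `s = 1/r`. For `t ≤ r` the product `t s` is at most `1`;
for `t ≥ r`, convexity between `0` and `t` gives `t/r ≤ φ(t)`. So the conjugate at `s` is at most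
`1`. -/
theorem IsYoung.conj_exists_pos_lt_top {φ : ℝ≥0 → ℝ≥0∞} (hφ : IsYoung φ) :
    ∃ s, 0 < s ∧ conj φ s < ∞ := by
  have h1 : ∀ᶠ t in atTop, 1 < φ t := hφ.tendsto_top.eventually (lt_mem_nhds (by simp))
  obtain ⟨r, hr, hr0⟩ := (h1.and (eventually_gt_atTop 0)).exists
  refine ⟨r⁻¹, inv_pos.2 hr0, lt_of_le_of_lt (iSup_le fun t => ?_) ENNReal.one_lt_top⟩
  rw [tsub_le_iff_right, ← ENNReal.coe_mul]
  rcases le_total t r with htr | htr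
  · refine le_add_right ?_
    rw [← ENNReal.coe_one, ENNReal.coe_le_coe]
    rw [← div_eq_mul_inv]
    exact div_le_one_of_le₀ htr bot_le
  · refine le_add_left ?_
    have ht0 : 0 < t := hr0.trans_le htr
    have hc := hφ.convex.2 (mem_univ 0) (mem_univ t) (bot_le : 0 ≤ 1 - r / t) (bot_le : 0 ≤ r / t)
      (tsub_add_cancel_of_le (div_le_one_of_le₀ htr bot_le))
    rw [hφ.map_zero] at hc
    simp only [smul_zero, zero_add, smul_eq_mul] at hc
    rw [div_mul_cancel₀ _ ht0.ne', ENNReal.smul_def, smul_eq_mul, mul_zero, zero_add] at hc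
    calc ((t * r⁻¹ : ℝ≥0) : ℝ≥0∞) = ((t * r⁻¹ : ℝ≥0) : ℝ≥0∞) * 1 := (mul_one _).symm
      _ ≤ ((t * r⁻¹ : ℝ≥0) : ℝ≥0∞) * (((r / t : ℝ≥0) : ℝ≥0∞) * φ t) := by
        gcongr; exact hr.le.trans hc
      _ = φ t := by
        rw [← mul_assoc, ← ENNReal.coe_mul]
        have : t * r⁻¹ * (r / t) = 1 := by field_simp
        rw [this]; simp

end Young

/-! ### Orlicz spaces: domination, vector operations and duality. -/

section Orlicz

variable {Ω : Type*} {m m0 : MeasurableSpace Ω} {μ : Measure[m0] Ω} {φ : ℝ≥0 → ℝ≥0∞}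

theorem measurable_comp_nnnorm_div_const (hφ : Monotone φ) (x : Ω →ₘ[μ] ℝ) (c : ℝ≥0) :
    Measurable fun ω => φ (‖x ω‖₊ / c) :=
  hφ.measurable.comp (x.measurable.nnnorm.div_const c)

/-- Monotonicity alone suffices, because `φ` of a maximum is one of the two values and hence at most
their sum. Sums, differences, glued elements and bounded multiples are all instances. -/
theorem mem_orlicz_of_le_max (hφ : Monotone φ) {x y z : Ω →ₘ[μ] ℝ}
    (hx : x ∈ orlicz m0 μ φ) (hy : y ∈ orlicz m0 μ φ) (hz : z ∈ L0 m μ) (C : ℝ≥0)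
    (h : ∀ᵐ ω ∂μ, |z ω| ≤ C * max |x ω| |y ω|) : z ∈ orlicz m μ φ := by
  obtain ⟨-, c, hc, hxc⟩ := hx
  obtain ⟨-, d, hd, hyd⟩ := hy
  -- The scale uses `C + 1` rather than `C` to stay positive when `C = 0`.
  refine ⟨hz, (C + 1) * max c d, by positivity, ?_⟩
  refine lt_of_le_of_lt (lintegral_mono_ae ?_) (by
    rw [lintegral_add_left (measurable_comp_nnnorm_div_const hφ x c)]
    exact ENNReal.add_lt_top.2 ⟨hxc, hyd⟩ :
      ∫⁻ ω, (φ (‖x ω‖₊ / c) + φ (‖y ω‖₊ / d)) ∂μ < ∞)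
  filter_upwards [h] with ω hω
  have h' : ‖z ω‖₊ ≤ C * max ‖x ω‖₊ ‖y ω‖₊ := by
    rw [← NNReal.coe_le_coe]
    push_cast
    simpa using hω
  have h2 : ‖z ω‖₊ / ((C + 1) * max c d) ≤ max (‖x ω‖₊ / c) (‖y ω‖₊ / d) := by
    rw [div_le_iff₀ (by positivity)]
    refine h'.trans ?_
    have h3 : max ‖x ω‖₊ ‖y ω‖₊ ≤ max (‖x ω‖₊ / c) (‖y ω‖₊ / d) * max c d := by
      refine max_le ?_ ?_
      · calc ‖x ω‖₊ = ‖x ω‖₊ / c * c := by field_simp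
          _ ≤ _ := by gcongr <;> simp
      · calc ‖y ω‖₊ = ‖y ω‖₊ / d * d := by field_simp
          _ ≤ _ := by gcongr <;> simp
    calc C * max ‖x ω‖₊ ‖y ω‖₊ ≤ (C + 1) * (max (‖x ω‖₊ / c) (‖y ω‖₊ / d) * max c d) := by
          gcongr; simp
      _ = _ := by ring
  refine (hφ h2).trans ?_
  rcases max_choice (‖x ω‖₊ / c) (‖y ω‖₊ / d) with h | h <;> rw [h]
  · exact le_self_add
  · exact le_add_self

theorem mem_orlicz_of_bounded [IsFiniteMeasure μ] (hφ : Monotone φ) (h0 : ∃ t, 0 < t ∧ φ t < ∞)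
    {z : Ω →ₘ[μ] ℝ} (hz : z ∈ L0 m μ) (C : ℝ≥0) (h : ∀ᵐ ω ∂μ, |z ω| ≤ C) : z ∈ orlicz m μ φ := by
  obtain ⟨t, ht, hφt⟩ := h0
  refine ⟨hz, (C + 1) / t, by positivity, ?_⟩
  refine lt_of_le_of_lt (lintegral_mono_ae (g := fun _ => φ t) ?_) ?_
  · filter_upwards [h] with ω hω
    apply hφ
    have h' : ‖z ω‖₊ ≤ C := by
      rw [← NNReal.coe_le_coe]; simpa using hω
    rw [div_le_iff₀ (by positivity)]
    calc ‖z ω‖₊ ≤ C + 1 := h'.trans (by simp)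
      _ = t * ((C + 1) / t) := by field_simp
  · rw [lintegral_const]
    exact ENNReal.mul_lt_top hφt (measure_lt_top _ _)

theorem add_mem_orlicz (hφ : Monotone φ) {x y : Ω →ₘ[μ] ℝ} (hx : x ∈ orlicz m0 μ φ)
    (hy : y ∈ orlicz m0 μ φ) : x + y ∈ orlicz m0 μ φ := by
  refine mem_orlicz_of_le_max hφ hx hy (mem_L0_top _) 2 ?_
  filter_upwards [AEEqFun.coeFn_add x y] with ω h
  rw [h, Pi.add_apply]
  have := abs_add_le (x ω) (y ω)
  have h1 := le_max_left |x ω| |y ω|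
  have h2 := le_max_right |x ω| |y ω|
  push_cast
  linarith

theorem sub_mem_orlicz (hφ : Monotone φ) {x y : Ω →ₘ[μ] ℝ} (hx : x ∈ orlicz m0 μ φ)
    (hy : y ∈ orlicz m0 μ φ) : x - y ∈ orlicz m0 μ φ := by
  refine mem_orlicz_of_le_max hφ hx hy (mem_L0_top _) 2 ?_
  filter_upwards [AEEqFun.coeFn_sub x y] with ω h
  rw [h, Pi.sub_apply]
  have := abs_sub (x ω) (y ω)
  have h1 := le_max_left |x ω| |y ω|
  have h2 := le_max_right |x ω| |y ω|
  push_cast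
  linarith

theorem orlicz_mono_measurableSpace {x : Ω →ₘ[μ] ℝ} (hx : x ∈ orlicz m μ φ) :
    x ∈ orlicz m0 μ φ := ⟨mem_L0_top _, hx.2⟩

theorem mem_orlicz_of_glue (hφ : Monotone φ) {A : Set Ω} {x y z : Ω →ₘ[μ] ℝ}
    (hx : x ∈ orlicz m0 μ φ) (hy : y ∈ orlicz m0 μ φ)
    (hz : ∀ᵐ ω ∂μ, (ω ∈ A → z ω = x ω) ∧ (ω ∉ A → z ω = y ω)) : z ∈ orlicz m0 μ φ := by
  refine mem_orlicz_of_le_max hφ hx hy (mem_L0_top _) 1 ?_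
  filter_upwards [hz] with ω h
  by_cases hω : ω ∈ A
  · simp [h.1 hω]
  · simp [h.2 hω]

/-- Hölder-type duality of the Orlicz spaces of `φ` and `φ*`. -/
theorem integrable_mul_of_mem_orlicz (hφ : Monotone φ) {x y : Ω →ₘ[μ] ℝ}
    (hx : x ∈ orlicz m0 μ φ) (hy : y ∈ orlicz m0 μ (conj φ)) :
    Integrable (fun ω => x ω * y ω) μ := by
  obtain ⟨-, c, hc, hxc⟩ := hx
  obtain ⟨-, d, hd, hyd⟩ := hy
  refine ⟨(x.measurable.mul y.measurable).aestronglyMeasurable, ?_⟩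
  have h : ∀ ω, ‖x ω * y ω‖ₑ ≤ ((c * d : ℝ≥0) : ℝ≥0∞) * (φ (‖x ω‖₊ / c) + conj φ (‖y ω‖₊ / d)) := by
    intro ω
    calc ‖x ω * y ω‖ₑ = ((c * d : ℝ≥0) : ℝ≥0∞) *
          (((‖x ω‖₊ / c : ℝ≥0) : ℝ≥0∞) * ((‖y ω‖₊ / d : ℝ≥0) : ℝ≥0∞)) := by
          rw [← ENNReal.coe_mul, ← ENNReal.coe_mul, enorm_eq_nnnorm, nnnorm_mul]
          congr 1
          field_simp
      _ ≤ _ := by gcongr; exact mul_le_add_conj φ _ _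
  refine lt_of_le_of_lt (lintegral_mono h) ?_
  rw [lintegral_const_mul' _ _ ENNReal.coe_ne_top,
    lintegral_add_left (measurable_comp_nnnorm_div_const hφ x c)]
  exact ENNReal.mul_lt_top ENNReal.coe_lt_top (ENNReal.add_lt_top.2 ⟨hxc, hyd⟩)

end Orlicz

/-! ### The Orlicz module as the concatenation hull of the Orlicz space. -/

section Module

variable {Ω : Type*} {m m0 : MeasurableSpace Ω} {μ : Measure[m0] Ω} {φ : ℝ≥0 → ℝ≥0∞}

/-- Concatenations of elements of the Orlicz space belong to the Orlicz module. -/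
theorem mem_orliczModule_of_concat (hm : m ≤ m0) [IsFiniteMeasure μ]
    {A : ℕ → Set Ω} (hA : IsPartition m A) {xs : ℕ → (Ω →ₘ[μ] ℝ)}
    (hxs : ∀ k, xs k ∈ orlicz m0 μ φ) {x : Ω →ₘ[μ] ℝ} (hx : IsConcat A xs x) :
    x ∈ orliczModule m μ φ := by
  choose _ c hc hxc using hxs
  obtain ⟨f, hf, h⟩ := @exists_measurable_piecewise Ω ℝ m _ ℕ _ _ A hA.1 (fun k _ => (c k : ℝ))
    (fun k => @measurable_const _ _ _ m _)
    (fun i j hij ω hω => absurd hω.2 (disjoint_left.1 (hA.2.1 hij) hω.1))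
  obtain ⟨l, hl, hlf⟩ := exists_class_of_stronglyMeasurable (μ := μ) hm
    (Measurable.stronglyMeasurable hf)
  refine ⟨l, ⟨hl, ?_⟩, ?_⟩
  · filter_upwards [hlf] with ω hω
    obtain ⟨k, hk⟩ := mem_iUnion.1 (hA.2.2 ▸ mem_univ ω)
    rw [hω, h k hk]
    exact hc k
  · have hk : ∀ k, ∀ᵐ ω ∂μ, ω ∈ A k → condLExp m μ (fun ω => φ (‖x ω‖₊ / ‖l ω‖₊)) ω < ∞ := by
      intro k
      have hA0 := hm _ (hA.1 k)
      rw [← ae_restrict_iff' hA0]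
      -- On `A k` the scale `l` is the constant `c k`, so the conditional modular has finite
      -- integral there and is therefore finite almost everywhere.
      refine ae_lt_top' (measurable_condLExp' _ _ _).aemeasurable ?_
      rw [setLIntegral_condLExp hm _ _ (hA.1 k)]
      refine ne_top_of_le_ne_top (hxc k).ne ((setLIntegral_mono_ae' hA0 ?_).trans
        (setLIntegral_le_lintegral (A k) _))
      filter_upwards [hx k, hlf] with ω h1 h2 hω
      rw [h1 hω, h2, h k hω]
      simp
    filter_upwards [ae_all_iff.2 hk] with ω hω
    obtain ⟨k, hk⟩ := mem_iUnion.1 (hA.2.2 ▸ mem_univ ω)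
    exact hω k hk

/-- Every element of the Orlicz module is a concatenation of elements of the Orlicz space. -/
theorem exists_concat_of_mem_orliczModule (hm : m ≤ m0) [IsFiniteMeasure μ] (hφ : Monotone φ)
    (hφ0 : φ 0 = 0) {x : Ω →ₘ[μ] ℝ} (hx : x ∈ orliczModule m μ φ) :
    ∃ (A : ℕ → Set Ω) (xs : ℕ → (Ω →ₘ[μ] ℝ)),
      IsPartition m A ∧ (∀ k, xs k ∈ orlicz m0 μ φ) ∧ IsConcat A xs x := by
  classical
  obtain ⟨l, ⟨⟨f, hf, hlf⟩, hl0⟩, hfin⟩ := hx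
  set g := condLExp m μ (fun ω => φ (‖x ω‖₊ / ‖l ω‖₊)) with hg
  have hgm : Measurable[m] g := measurable_condLExp _ _ _
  -- The pieces are the level sets of the ceiling of `h`. On the `k`-th one the random scale and the
  -- conditional modular are both at most `k`, so the constant scale `k + 1` has finite modular.
  let h : Ω → ℝ := fun ω => max |f ω| (g ω).toReal
  have hhm : Measurable[m] h :=
    (measurable_fst.max measurable_snd).comp ((measurable_norm.comp hf.measurable).prodMk
      (ENNReal.measurable_toReal.comp hgm))
  let N : Ω → ℕ := fun ω => ⌈h ω⌉₊
  have hNm : Measurable[m] N := Nat.measurable_ceil.comp hhm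
  let A : ℕ → Set Ω := fun k => N ⁻¹' {k}
  have hAm : ∀ k, MeasurableSet[m] (A k) := fun k => hNm (measurableSet_singleton k)
  have hxs : ∀ k, ∃ z : Ω →ₘ[μ] ℝ, ∀ᵐ ω ∂μ,
      (ω ∈ A k → z ω = x ω) ∧ (ω ∉ A k → z ω = (0 : Ω →ₘ[μ] ℝ) ω) :=
    fun k => exists_glue (hm _ (hAm k)) _ _
  choose xs hxs using hxs
  refine ⟨A, xs, ⟨hAm, ?_, ?_⟩, fun k => ⟨mem_L0_top _, k + 1, by positivity, ?_⟩, fun k => ?_⟩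
  · intro i j hij
    exact Disjoint.preimage _ (disjoint_singleton.2 hij)
  · exact iUnion_eq_univ_iff.2 fun ω => ⟨N ω, rfl⟩
  · have hA0 := hm _ (hAm k)
    calc ∫⁻ ω, φ (‖xs k ω‖₊ / (k + 1)) ∂μ
        ≤ ∫⁻ ω, (A k).indicator (fun ω => φ (‖x ω‖₊ / ‖l ω‖₊)) ω ∂μ := by
          refine lintegral_mono_ae ?_
          filter_upwards [hxs k, AEEqFun.coeFn_zero (β := ℝ) (μ := μ), hlf, hl0] with ω h1 h2 h3 h4
          by_cases hω : ω ∈ A k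
          · rw [indicator_of_mem hω, h1.1 hω]
            apply hφ
            have h5 : ‖l ω‖₊ ≤ (k : ℝ≥0) + 1 := by
              rw [← NNReal.coe_le_coe]
              push_cast
              rw [Real.norm_eq_abs, h3]
              have : h ω ≤ k := by
                have := Nat.le_ceil (h ω)
                rwa [show ⌈h ω⌉₊ = k from hω] at this
              linarith [le_max_left |f ω| (g ω).toReal]
            have h6 : 0 < ‖l ω‖₊ := by simpa using h4.ne'
            gcongr
          · rw [h1.2 hω, h2]
            simp [hφ0]
      _ = ∫⁻ ω in A k, g ω ∂μ := by
          rw [lintegral_indicator hA0, hg, setLIntegral_condLExp hm _ _ (hAm k)]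
      _ ≤ ∫⁻ ω in A k, (k : ℝ≥0∞) ∂μ := by
          refine setLIntegral_mono_ae' hA0 ?_
          filter_upwards [hfin] with ω h1 hω
          have h2 : (g ω).toReal ≤ k := by
            have := Nat.le_ceil (h ω)
            rw [show ⌈h ω⌉₊ = k from hω] at this
            exact (le_max_right _ _).trans this
          rw [← ENNReal.ofReal_toReal h1.ne]
          simpa using ENNReal.ofReal_le_ofReal h2
      _ < ∞ := by
          rw [setLIntegral_const]
          exact ENNReal.mul_lt_top (by simp) (measure_lt_top _ _)
  · filter_upwards [hxs k] with ω h1 hω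
    rw [h1.1 hω]

end Module

/-! ### Concatenation hulls, locality and stable extensions. -/

section Hull

variable {Ω : Type*} {m m0 : MeasurableSpace Ω} {μ : Measure[m0] Ω}

variable (m) in
/-- The countable concatenation hull of `D` over `m`-measurable partitions. -/
def hull (D : Set (Ω →ₘ[μ] ℝ)) : Set (Ω →ₘ[μ] ℝ) :=
  {x | ∃ (A : ℕ → Set Ω) (xs : ℕ → (Ω →ₘ[μ] ℝ)),
    IsPartition m A ∧ (∀ k, xs k ∈ D) ∧ IsConcat A xs x}

variable (m) in
/-- `f` is local on `D`: on `m`-measurable sets its values depend only on the values of the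
argument there. -/
def IsLocalOn (D : Set (Ω →ₘ[μ] ℝ)) (f : (Ω →ₘ[μ] ℝ) → (Ω →ₘ[μ] ℝ)) : Prop :=
  ∀ x ∈ D, ∀ x' ∈ D, ∀ A, MeasurableSet[m] A → (∀ᵐ ω ∂μ, ω ∈ A → x ω = x' ω) →
    ∀ᵐ ω ∂μ, ω ∈ A → f x ω = f x' ω

theorem IsPartition.exists_mem {A : ℕ → Set Ω} (hA : IsPartition m A) (ω : Ω) : ∃ k, ω ∈ A k :=
  mem_iUnion.1 (hA.2.2 ▸ mem_univ ω)

theorem IsPartition.ae_of_forall {A : ℕ → Set Ω} (hA : IsPartition m A) {p : Ω → Prop}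
    (h : ∀ k, ∀ᵐ ω ∂μ, ω ∈ A k → p ω) : ∀ᵐ ω ∂μ, p ω := by
  filter_upwards [ae_all_iff.2 h] with ω hω
  obtain ⟨k, hk⟩ := hA.exists_mem ω
  exact hω k hk

theorem IsPartition.inter {A B : ℕ → Set Ω} (hA : IsPartition m A) (hB : IsPartition m B) :
    IsPartition m fun n => A n.unpair.1 ∩ B n.unpair.2 := by
  refine ⟨fun n => (hA.1 _).inter (hB.1 _), fun i j hij => ?_, iUnion_eq_univ_iff.2 fun ω => ?_⟩
  · refine disjoint_left.2 ?_
    rintro ω ⟨h1, h2⟩ ⟨h3, h4⟩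
    apply hij
    have e1 : i.unpair.1 = j.unpair.1 := by
      by_contra h; exact disjoint_left.1 (hA.2.1 h) h1 h3
    have e2 : i.unpair.2 = j.unpair.2 := by
      by_contra h; exact disjoint_left.1 (hB.2.1 h) h2 h4
    rw [← Nat.pair_unpair i, ← Nat.pair_unpair j, e1, e2]
  · obtain ⟨k, hk⟩ := hA.exists_mem ω
    obtain ⟨l, hl⟩ := hB.exists_mem ω
    exact ⟨Nat.pair k l, by simpa using ⟨hk, hl⟩⟩

/-- Pointwise binary operations pass to hulls by taking the common refinement of the two partitions.
-/
theorem hull_map₂ {D₁ D₂ D : Set (Ω →ₘ[μ] ℝ)} (op : (Ω →ₘ[μ] ℝ) → (Ω →ₘ[μ] ℝ) → (Ω →ₘ[μ] ℝ))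
    (F : ℝ → ℝ → ℝ) (hop : ∀ x y, ∀ᵐ ω ∂μ, op x y ω = F (x ω) (y ω))
    (hD : ∀ x ∈ D₁, ∀ y ∈ D₂, op x y ∈ D) {x y : Ω →ₘ[μ] ℝ} (hx : x ∈ hull m D₁)
    (hy : y ∈ hull m D₂) : op x y ∈ hull m D := by
  obtain ⟨A, xs, hA, hxs, hAx⟩ := hx
  obtain ⟨B, ys, hB, hys, hBy⟩ := hy
  refine ⟨_, fun n => op (xs n.unpair.1) (ys n.unpair.2), hA.inter hB,
    fun n => hD _ (hxs _) _ (hys _), fun n => ?_⟩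
  filter_upwards [hAx n.unpair.1, hBy n.unpair.2, hop x y,
    hop (xs n.unpair.1) (ys n.unpair.2)] with ω h1 h2 h3 h4 hω
  rw [h3, h4, h1 hω.1, h2 hω.2]

theorem subset_hull (D : Set (Ω →ₘ[μ] ℝ)) : D ⊆ hull m D := by
  intro x hx
  refine ⟨fun k => if k = 0 then univ else ∅, fun _ => x, ⟨?_, ?_, ?_⟩, fun _ => hx,
    fun k => ae_of_all _ fun _ _ => rfl⟩
  · intro k; dsimp only; split_ifs
    exacts [@MeasurableSet.univ _ m, @MeasurableSet.empty _ m]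
  · intro i j hij
    by_cases hi : i = 0
    · have : j ≠ 0 := fun h => hij (hi.trans h.symm)
      simp [this]
    · simp [hi]
  · exact iUnion_eq_univ_iff.2 fun ω => ⟨0, by simp⟩

/-- An element of the hull agrees with an element of `D` on a piece of positive measure of every
set of positive measure. -/
theorem exists_subset_eq_of_mem_hull {D : Set (Ω →ₘ[μ] ℝ)} {x : Ω →ₘ[μ] ℝ} (hx : x ∈ hull m D)
    {B : Set Ω} (hBm : MeasurableSet[m] B) (hB : μ B ≠ 0) :
    ∃ B' ⊆ B, MeasurableSet[m] B' ∧ μ B' ≠ 0 ∧ ∃ x' ∈ D, ∀ᵐ ω ∂μ, ω ∈ B' → x ω = x' ω := by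
  obtain ⟨A, xs, hA, hxs, hAx⟩ := hx
  obtain ⟨n, hn⟩ := exists_measure_inter_pos hB (ae_of_all μ fun ω _ => hA.exists_mem ω)
  refine ⟨_, inter_subset_left, hBm.inter (hA.1 n), hn, xs n, hxs n, ?_⟩
  filter_upwards [hAx n] with ω h hω using h hω.2

variable {D : Set (Ω →ₘ[μ] ℝ)} {f : (Ω →ₘ[μ] ℝ) → (Ω →ₘ[μ] ℝ)}

theorem stableExt_spec (hm : m ≤ m0) {x : Ω →ₘ[μ] ℝ} (hx : x ∈ hull m D) :
    ∃ (A : ℕ → Set Ω) (xs : ℕ → (Ω →ₘ[μ] ℝ)), IsPartition m A ∧ (∀ k, xs k ∈ D) ∧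
      IsConcat A xs x ∧ IsConcat A (fun k => f (xs k)) (stableExt m D f x) := by
  have h : ∃ z, ∃ (A : ℕ → Set Ω) (xs : ℕ → (Ω →ₘ[μ] ℝ)), IsPartition m A ∧ (∀ k, xs k ∈ D) ∧
      IsConcat A xs x ∧ IsConcat A (fun k => f (xs k)) z := by
    obtain ⟨A, xs, hA, hxs, hAx⟩ := hx
    obtain ⟨z, hz⟩ := exists_concat (fun k => hm _ (hA.1 k)) hA.2.1 fun k => f (xs k)
    exact ⟨z, A, xs, hA, hxs, hAx, hz⟩
  exact Classical.epsilon_spec h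

theorem stableExt_mem_L0 (hm : m ≤ m0) (hf : ∀ x ∈ D, f x ∈ L0 m μ) {x : Ω →ₘ[μ] ℝ}
    (hx : x ∈ hull m D) : stableExt m D f x ∈ L0 m μ := by
  obtain ⟨A, xs, hA, hxs, -, h⟩ := stableExt_spec (f := f) hm hx
  exact mem_L0_of_concat hA (fun k => hf _ (hxs k)) h

/-- Whichever decomposition was chosen to define the extension, locality of `f` compares the value
on each of its pieces with `f x'`. This is the independence of representatives that makes the
extension usable. -/
theorem stableExt_eq_on (hm : m ≤ m0) (hf : IsLocalOn m D f) {x x' : Ω →ₘ[μ] ℝ}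
    (hx : x ∈ hull m D) (hx' : x' ∈ D) {A : Set Ω} (hA : MeasurableSet[m] A)
    (h : ∀ᵐ ω ∂μ, ω ∈ A → x ω = x' ω) : ∀ᵐ ω ∂μ, ω ∈ A → stableExt m D f x ω = f x' ω := by
  obtain ⟨B, xs, hB, hxs, hBx, hBf⟩ := stableExt_spec (f := f) hm hx
  refine hB.ae_of_forall fun k => ?_
  have := hf (xs k) (hxs k) x' hx' (A ∩ B k) (hA.inter (hB.1 k)) (by
    filter_upwards [h, hBx k] with ω h1 h2 hω
    rw [← h2 hω.2, h1 hω.1])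
  filter_upwards [this, hBf k] with ω h1 h2 hωB hωA
  rw [h2 hωB, h1 ⟨hωA, hωB⟩]

theorem stableExt_eq (hm : m ≤ m0) (hf : IsLocalOn m D f) {x : Ω →ₘ[μ] ℝ} (hx : x ∈ D) :
    stableExt m D f x = f x := by
  refine AEEqFun.ext ?_
  filter_upwards [stableExt_eq_on hm hf (subset_hull D hx) hx (@MeasurableSet.univ _ m)
    (ae_of_all μ fun _ _ => rfl)] with ω h using h trivial

theorem isLocalOn_stableExt (hm : m ≤ m0) (hf : IsLocalOn m D f) :
    IsLocalOn m (hull m D) (stableExt m D f) := by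
  intro x hx x' hx' A hA h
  obtain ⟨B, xs, hB, hxs, hBx, hBf⟩ := stableExt_spec (f := f) hm hx'
  refine hB.ae_of_forall fun k => ?_
  have := stableExt_eq_on hm hf hx (hxs k) (hA.inter (hB.1 k)) (by
    filter_upwards [h, hBx k] with ω h1 h2 hω
    rw [h1 hω.1, h2 hω.2])
  filter_upwards [this, hBf k] with ω h1 h2 hωB hωA
  rw [h2 hωB, h1 ⟨hωA, hωB⟩]

end Hull

/-! ### Locality and linearity of the extended conditional expectation. -/

section CondE

variable {Ω : Type*} {m m0 : MeasurableSpace Ω} {μ : Measure[m0] Ω}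

theorem condE_mem_L0 (x : Ω →ₘ[μ] ℝ) : condE m μ x ∈ L0 m μ :=
  mem_L0_of_ae_eq stronglyMeasurable_condExp (AEEqFun.coeFn_mk _ _)

theorem coeFn_condE (x : Ω →ₘ[μ] ℝ) : condE m μ x =ᵐ[μ] μ[x | m] := AEEqFun.coeFn_mk _ _

theorem coeFn_condE_mul (x y : Ω →ₘ[μ] ℝ) :
    condE m μ (x * y) =ᵐ[μ] μ[fun ω => x ω * y ω | m] :=
  (coeFn_condE _).trans (condExp_congr_ae (AEEqFun.coeFn_mul x y))

theorem condExp_eq_on (hm : m ≤ m0) {f g : Ω → ℝ} (hf : Integrable f μ) (hg : Integrable g μ)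
    {A : Set Ω} (hA : MeasurableSet[m] A) (h : ∀ᵐ ω ∂μ, ω ∈ A → f ω = g ω) :
    ∀ᵐ ω ∂μ, ω ∈ A → μ[f | m] ω = μ[g | m] ω := by
  have h0 : f - g =ᵐ[μ.restrict A] 0 := by
    rw [EventuallyEq, ae_restrict_iff' (hm _ hA)]
    filter_upwards [h] with ω h hω
    simp [h hω]
  have h1 := condExp_ae_eq_restrict_zero hA h0
  rw [EventuallyEq, ae_restrict_iff' (hm _ hA)] at h1
  filter_upwards [h1, condExp_sub hf hg m] with ω h2 h3 hω
  have := h2 hω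
  rw [h3] at this
  simpa [sub_eq_zero] using this

theorem isLocalOn_condE (hm : m ≤ m0) :
    IsLocalOn m {z : Ω →ₘ[μ] ℝ | Integrable z μ} (condE m μ) := by
  intro x hx x' hx' A hA h
  filter_upwards [condExp_eq_on hm hx hx' hA h, coeFn_condE (m := m) x,
    coeFn_condE (m := m) x'] with ω h1 h2 h3 hω
  rw [h2, h3, h1 hω]

theorem condEExt_eq (hm : m ≤ m0) {x : Ω →ₘ[μ] ℝ} (hx : Integrable x μ) :
    condEExt m μ x = condE m μ x := stableExt_eq hm (isLocalOn_condE hm) hx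

theorem condEExt_eq_on (hm : m ≤ m0) {x x' : Ω →ₘ[μ] ℝ}
    (hx : x ∈ hull m {z : Ω →ₘ[μ] ℝ | Integrable z μ}) (hx' : Integrable x' μ) {A : Set Ω}
    (hA : MeasurableSet[m] A) (h : ∀ᵐ ω ∂μ, ω ∈ A → x ω = x' ω) :
    ∀ᵐ ω ∂μ, ω ∈ A → condEExt m μ x ω = condE m μ x' ω :=
  stableExt_eq_on hm (isLocalOn_condE hm) hx hx' hA h

theorem condEExt_mem_L0 (hm : m ≤ m0) {x : Ω →ₘ[μ] ℝ}
    (hx : x ∈ hull m {z : Ω →ₘ[μ] ℝ | Integrable z μ}) : condEExt m μ x ∈ L0 m μ :=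
  stableExt_mem_L0 hm (fun _ _ => condE_mem_L0 _) hx

theorem condEExt_sub (hm : m ≤ m0) {x y : Ω →ₘ[μ] ℝ}
    (hx : x ∈ hull m {z : Ω →ₘ[μ] ℝ | Integrable z μ})
    (hy : y ∈ hull m {z : Ω →ₘ[μ] ℝ | Integrable z μ}) :
    ∀ᵐ ω ∂μ, condEExt m μ (x - y) ω = condEExt m μ x ω - condEExt m μ y ω := by
  have hsub : ∀ x y : Ω →ₘ[μ] ℝ, Integrable x μ → Integrable y μ → Integrable ↑(x - y) μ :=
    fun x y hx hy => (hx.sub hy).congr (AEEqFun.coeFn_sub x y).symm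
  have hxy : x - y ∈ hull m {z : Ω →ₘ[μ] ℝ | Integrable z μ} :=
    hull_map₂ (fun x y => x - y) (fun a b => a - b) (fun x y => AEEqFun.coeFn_sub x y)
      (fun x hx y hy => hsub x y hx hy) hx hy
  obtain ⟨A, xs, hA, hxs, hAx, hAf⟩ := stableExt_spec (f := condE m μ) hm hx
  obtain ⟨B, ys, hB, hys, hBx, hBf⟩ := stableExt_spec (f := condE m μ) hm hy
  refine hA.ae_of_forall fun k => hB.ae_of_forall fun l => ?_
  have h := condEExt_eq_on hm hxy (hsub _ _ (hxs k) (hys l)) ((hA.1 k).inter (hB.1 l)) (by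
    filter_upwards [hAx k, hBx l, AEEqFun.coeFn_sub x y, AEEqFun.coeFn_sub (xs k) (ys l)]
      with ω h1 h2 h3 h4 hω
    rw [h3, h4, Pi.sub_apply, Pi.sub_apply, h1 hω.1, h2 hω.2])
  filter_upwards [h, hAf k, hBf l, coeFn_condE (m := m) (xs k), coeFn_condE (m := m) (ys l),
    coeFn_condE (m := m) (xs k - ys l), condExp_sub (hxs k) (hys l) m,
    condExp_congr_ae (m := m) (AEEqFun.coeFn_sub (xs k) (ys l))]
    with ω h1 h2 h3 h4 h5 h6 h7 h8 hωB hωA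
  rw [h1 ⟨hωA, hωB⟩, h6, h8, h7, Pi.sub_apply, ← h4, ← h5]
  change _ = stableExt m _ _ x ω - stableExt m _ _ y ω
  rw [h2 hωA, h3 hωB]

end CondE

/-! ### The pairing between an Orlicz module and its conjugate module. -/

section Pairing

variable {Ω : Type*} {m m0 : MeasurableSpace Ω} {μ : Measure[m0] Ω} {φ : ℝ≥0 → ℝ≥0∞}

theorem orliczModule_eq_hull (hm : m ≤ m0) [IsFiniteMeasure μ] (hφ : Monotone φ) (hφ0 : φ 0 = 0) :
    orliczModule m μ φ = hull m (orlicz m0 μ φ) := by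
  ext x
  refine ⟨fun hx => exists_concat_of_mem_orliczModule hm hφ hφ0 hx, ?_⟩
  rintro ⟨A, xs, hA, hxs, hAx⟩
  exact mem_orliczModule_of_concat hm hA hxs hAx

theorem conj_zero (φ : ℝ≥0 → ℝ≥0∞) : conj φ 0 = 0 := by simp [conj]

theorem integrable_coeFn_mul (hφ : Monotone φ) {x y : Ω →ₘ[μ] ℝ}
    (hx : x ∈ orlicz m0 μ φ) (hy : y ∈ orlicz m0 μ (conj φ)) : Integrable ↑(x * y) μ :=
  (integrable_mul_of_mem_orlicz hφ hx hy).congr (AEEqFun.coeFn_mul x y).symm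

theorem mul_mem_hull (hφ : Monotone φ) {x y : Ω →ₘ[μ] ℝ}
    (hx : x ∈ hull m (orlicz m0 μ φ)) (hy : y ∈ hull m (orlicz m0 μ (conj φ))) :
    x * y ∈ hull m {z : Ω →ₘ[μ] ℝ | Integrable z μ} :=
  hull_map₂ (fun x y => x * y) (fun a b => a * b) (fun x y => AEEqFun.coeFn_mul x y)
    (fun _ hx _ hy => integrable_coeFn_mul hφ hx hy) hx hy

theorem sub_mem_hull (hφ : Monotone φ) {x y : Ω →ₘ[μ] ℝ}
    (hx : x ∈ hull m (orlicz m0 μ φ)) (hy : y ∈ hull m (orlicz m0 μ φ)) :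
    x - y ∈ hull m (orlicz m0 μ φ) :=
  hull_map₂ (fun x y => x - y) (fun a b => a - b) (fun x y => AEEqFun.coeFn_sub x y)
    (fun _ hx _ hy => sub_mem_orlicz hφ hx hy) hx hy

end Pairing

/-! ### Locality of conditional convex risk measures. -/

section RiskLocal

variable {Ω : Type*} {m m0 : MeasurableSpace Ω} {μ : Measure[m0] Ω} {φ ψ : ℝ≥0 → ℝ≥0∞}
  {ρ : (Ω →ₘ[μ] ℝ) → (Ω →ₘ[μ] ℝ)}

theorem IsCondConvexRiskMeasure.mem_L0 (hρ : IsCondConvexRiskMeasure m μ φ ψ ρ) {x : Ω →ₘ[μ] ℝ}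
    (hx : x ∈ orlicz m0 μ φ) : ρ x ∈ L0 m μ := (hρ.mapsTo hx).1

/-- Convexity along an `m`-measurable weight given as a function. -/
theorem IsCondConvexRiskMeasure.ae_le_of_convex (hm : m ≤ m0)
    (hρ : IsCondConvexRiskMeasure m μ φ ψ ρ) {x y z : Ω →ₘ[μ] ℝ} (hx : x ∈ orlicz m0 μ φ)
    (hy : y ∈ orlicz m0 μ φ) {l : Ω → ℝ} (hl : StronglyMeasurable[m] l) (h0 : ∀ ω, 0 ≤ l ω)
    (h1 : ∀ ω, l ω ≤ 1) (hz : ∀ᵐ ω ∂μ, z ω = l ω * x ω + (1 - l ω) * y ω) :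
    ∀ᵐ ω ∂μ, ρ z ω ≤ l ω * ρ x ω + (1 - l ω) * ρ y ω := by
  obtain ⟨L, hL, hLl⟩ := exists_class_of_stronglyMeasurable (μ := μ) hm hl
  have one := AEEqFun.coeFn_one (β := ℝ) (μ := μ)
  have key : ∀ u v : Ω →ₘ[μ] ℝ, ∀ᵐ ω ∂μ,
      (L * u + (1 - L) * v : Ω →ₘ[μ] ℝ) ω = l ω * u ω + (1 - l ω) * v ω := by
    intro u v
    filter_upwards [AEEqFun.coeFn_add (L * u) ((1 - L) * v), AEEqFun.coeFn_mul L u,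
      AEEqFun.coeFn_mul (1 - L) v, AEEqFun.coeFn_sub 1 L, one, hLl] with ω h1 h2 h3 h4 h5 h6
    rw [h1, Pi.add_apply, h2, h3, Pi.mul_apply, Pi.mul_apply, h4, Pi.sub_apply, h5, h6]
    rfl
  have hzz : z = L * x + (1 - L) * y := by
    refine AEEqFun.ext ?_
    filter_upwards [hz, key x y] with ω h h'
    rw [h, h']
  have hc := hρ.convex x hx y hy L hL
    (by
      rw [← AEEqFun.coeFn_le]
      filter_upwards [hLl, AEEqFun.coeFn_zero (β := ℝ) (μ := μ)] with ω h h'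
      rw [h, h']; exact h0 ω)
    (by
      rw [← AEEqFun.coeFn_le]
      filter_upwards [hLl, one] with ω h h'
      rw [h, h']; exact h1 ω)
  rw [← hzz, ← AEEqFun.coeFn_le] at hc
  filter_upwards [hc, key (ρ x) (ρ y)] with ω h h'
  rwa [h'] at h

/-- If `x = x'` on `A`, then `x = 1_A x' + (1 - 1_A) x`, so convexity with weight `1_A` gives `ρ x ≤
ρ x'` on `A`; exchanging the roles gives equality. -/
theorem IsCondConvexRiskMeasure.isLocalOn (hm : m ≤ m0)
    (hρ : IsCondConvexRiskMeasure m μ φ ψ ρ) : IsLocalOn m (orlicz m0 μ φ) ρ := by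
  have key : ∀ x ∈ orlicz m0 μ φ, ∀ x' ∈ orlicz m0 μ φ, ∀ A, MeasurableSet[m] A →
      (∀ᵐ ω ∂μ, ω ∈ A → x ω = x' ω) → ∀ᵐ ω ∂μ, ω ∈ A → ρ x ω ≤ ρ x' ω := by
    intro x hx x' hx' A hA h
    have := hρ.ae_le_of_convex hm hx' hx (z := x) (l := A.indicator fun _ => 1)
      (StronglyMeasurable.indicator (@stronglyMeasurable_const _ _ m _ _) hA)
      (fun ω => indicator_nonneg (fun _ _ => zero_le_one) ω)
      (fun ω => indicator_le_self' (fun _ _ => zero_le_one) ω) (by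
        filter_upwards [h] with ω h
        by_cases hω : ω ∈ A
        · simp [hω, h hω]
        · simp [hω])
    filter_upwards [this] with ω h hω
    simpa [hω] using h
  intro x hx x' hx' A hA h
  filter_upwards [key x hx x' hx' A hA h, key x' hx' x hx A hA
    (by filter_upwards [h] with ω h hω using (h hω).symm)] with ω h1 h2 hω
  exact le_antisymm (h1 hω) (h2 hω)

end RiskLocal

/-! ### Conditional separation from `0` by norm minimisation in a Hilbert space. -/

section Separation

variable {E : Type*} [NormedAddCommGroup E] [InnerProductSpace ℝ E]

/-- By the parallelogram law, two vectors of norm close to `d` whose midpoint has norm at least `d`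
must be close to each other. -/
theorem cauchySeq_of_midpoint_norm_ge {u : ℕ → E} {d : ℝ} (hd : 0 ≤ d)
    (hu : Tendsto (fun n => ‖u n‖) atTop (𝓝 d))
    (hmid : ∀ n k, d ≤ ‖(1 - (1 / 2 : ℝ)) • u n + (1 / 2 : ℝ) • u k‖) : CauchySeq u := by
  have hsq : Tendsto (fun n => ‖u n‖ ^ 2) atTop (𝓝 (d ^ 2)) := hu.pow 2
  rw [Metric.cauchySeq_iff]
  intro e he
  obtain ⟨N, hN⟩ := (hsq.eventually
    (gt_mem_nhds (by nlinarith : d ^ 2 < d ^ 2 + e ^ 2 / 8))).exists_forall_of_atTop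
  refine ⟨N, fun n hn k hk => ?_⟩
  have h1 := hN n hn
  have h2 := hN k hk
  have h3 := parallelogram_law_with_norm ℝ (u n) (u k)
  have h4 : 2 * d ≤ ‖u n + u k‖ := by
    have : (1 - (1 / 2 : ℝ)) • u n + (1 / 2 : ℝ) • u k = (1 / 2 : ℝ) • (u n + u k) := by
      rw [smul_add]; norm_num
    have h5 := hmid n k
    rw [this, norm_smul] at h5
    norm_num at h5
    linarith
  have h5 : (2 * d) ^ 2 ≤ ‖u n + u k‖ ^ 2 := by gcongr
  rw [dist_eq_norm]
  refine lt_of_pow_lt_pow_left₀ 2 he.le ?_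
  nlinarith

/-- The variational inequality for a point of minimal norm: expand `‖v + t(f - v)‖² ≥ ‖v‖²` with `t
= 1/(k+1)`, divide by `t`, and let `t` tend to `0`. -/
theorem norm_sq_le_inner_of_segment {u : ℕ → E} {d : ℝ} {v f : E} (hd : 0 ≤ d)
    (hu : Tendsto (fun n => ‖u n‖) atTop (𝓝 d)) (hv : Tendsto u atTop (𝓝 v))
    (hseg : ∀ n k : ℕ, d ≤ ‖(1 - (1 / (k + 1 : ℝ))) • u n + (1 / (k + 1 : ℝ)) • f‖) :
    d ^ 2 ≤ inner ℝ v f := by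
  have hvd : ‖v‖ = d := tendsto_nhds_unique hv.norm hu
  have h1 : ∀ k : ℕ, d ≤ ‖(1 - (1 / (k + 1 : ℝ))) • v + (1 / (k + 1 : ℝ)) • f‖ := fun k =>
    ge_of_tendsto' ((hv.const_smul _).add_const _).norm fun n => hseg n k
  have h2 : ∀ k : ℕ, 0 ≤ 2 * (inner ℝ v f - d ^ 2) + (1 / (k + 1 : ℝ)) * ‖f - v‖ ^ 2 := by
    intro k
    set t : ℝ := 1 / (k + 1 : ℝ) with ht
    have ht0 : 0 < t := by positivity
    have h3 : (1 - t) • v + t • f = v + t • (f - v) := by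
      rw [sub_smul, smul_sub, one_smul]; abel
    have h4 := h1 k
    rw [h3] at h4
    have h5 : d ^ 2 ≤ ‖v + t • (f - v)‖ ^ 2 := by gcongr
    rw [norm_add_sq_real, inner_smul_right, inner_sub_right, real_inner_self_eq_norm_sq, norm_smul,
      hvd, Real.norm_of_nonneg ht0.le, mul_pow] at h5
    have h6 : 0 ≤ t * (2 * (inner ℝ v f - d ^ 2) + t * ‖f - v‖ ^ 2) := by linarith
    exact nonneg_of_mul_nonneg_right h6 ht0
  have h3 : Tendsto (fun k : ℕ => 2 * (inner ℝ v f - d ^ 2) + (1 / (k + 1 : ℝ)) * ‖f - v‖ ^ 2)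
      atTop (𝓝 (2 * (inner ℝ v f - d ^ 2) + 0 * ‖f - v‖ ^ 2)) :=
    (tendsto_one_div_add_atTop_nhds_zero_nat.mul_const _).const_add _
  have := ge_of_tendsto' h3 h2
  linarith

variable {Ω : Type*} {m m0 : MeasurableSpace Ω} {μ : Measure[m0] Ω}

/-- Conditional separation of `0` from a set of random vectors that is convex, stable under gluing
along `m`-measurable sets, and bounded away from `0` on `D`. -/
theorem exists_stronglyMeasurable_inner_pos (hm : m ≤ m0) [IsFiniteMeasure μ] [CompleteSpace E]
    {K : Set (Ω → E)}
    (hne : K.Nonempty) (hmeas : ∀ f ∈ K, StronglyMeasurable[m] f)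
    (hconv : ∀ f ∈ K, ∀ g ∈ K, ∀ t : ℝ, 0 ≤ t → t ≤ 1 →
      ∃ h ∈ K, ∀ᵐ ω ∂μ, h ω = (1 - t) • f ω + t • g ω)
    (hglue : ∀ f ∈ K, ∀ g ∈ K, ∀ A, MeasurableSet[m] A →
      ∃ h ∈ K, ∀ᵐ ω ∂μ, (ω ∈ A → h ω = f ω) ∧ (ω ∉ A → h ω = g ω))
    {D : Set Ω} {e : Ω → ℝ}
    (he : ∀ᵐ ω ∂μ, ω ∈ D → 0 < e ω) (heK : ∀ f ∈ K, ∀ᵐ ω ∂μ, ω ∈ D → e ω ≤ ‖f ω‖) :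
    ∃ v : Ω → E, StronglyMeasurable[m] v ∧ ∀ f ∈ K, ∀ᵐ ω ∂μ, ω ∈ D → 0 < inner ℝ (v ω) (f ω) := by
  have : Nonempty K := hne.to_subtype
  have hnm : ∀ f : K, Measurable fun ω => ((-‖f.1 ω‖ : ℝ) : EReal) := fun f =>
    measurable_coe_real_ereal.comp (((hmeas f f.2).mono hm).norm.measurable.neg)
  -- Negated norms turn the essential infimum of the norms into an essential supremum, to which
  -- exhaustion applies.
  let F : K → (Ω →ₘ[μ] EReal) := fun f => AEEqFun.mk _ (hnm f).aestronglyMeasurable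
  have hF : ∀ f, F f =ᵐ[μ] fun ω => ((-‖f.1 ω‖ : ℝ) : EReal) := fun f => AEEqFun.coeFn_mk _ _
  obtain ⟨t, ht⟩ := exists_seq_forall_ae_le_iSup (range_nonempty F)
  choose s hs using fun n => (t n).2
  have hmin : ∀ f g : K, ∃ h : K, ∀ᵐ ω ∂μ, ‖h.1 ω‖ ≤ ‖f.1 ω‖ ∧ ‖h.1 ω‖ ≤ ‖g.1 ω‖ := by
    intro f g
    obtain ⟨h, hh, hω⟩ := hglue f f.2 g g.2 {ω | ‖f.1 ω‖ ≤ ‖g.1 ω‖}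
      (StronglyMeasurable.measurableSet_le (hmeas f f.2).norm (hmeas g g.2).norm)
    refine ⟨⟨h, hh⟩, ?_⟩
    filter_upwards [hω] with ω hω
    by_cases hle : ‖f.1 ω‖ ≤ ‖g.1 ω‖
    · rw [hω.1 hle]; exact ⟨le_rfl, hle⟩
    · rw [hω.2 hle]; exact ⟨(not_le.1 hle).le, le_rfl⟩
  choose M hM using hmin
  -- Running pointwise minima, which stay in `K` by gluing: their norms decrease almost everywhere
  -- to the essential infimum `d` of the norms over `K`.
  let w : ℕ → K := fun n => Nat.rec (s 0) (fun n f => M f (s (n + 1))) n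
  have hw : ∀ n, ∀ᵐ ω ∂μ, ‖(w (n + 1)).1 ω‖ ≤ ‖(w n).1 ω‖ := fun n => by
    filter_upwards [hM (w n) (s (n + 1))] with ω h using h.1
  have hws : ∀ n, ∀ᵐ ω ∂μ, ‖(w n).1 ω‖ ≤ ‖(s n).1 ω‖ := fun n => by
    cases n with
    | zero => exact ae_of_all _ fun ω => le_rfl
    | succ n => filter_upwards [hM (w n) (s (n + 1))] with ω h using h.2
  let d : Ω → ℝ := fun ω => ⨅ n, ‖(w n).1 ω‖
  have hbdd : ∀ ω, BddBelow (range fun n => ‖(w n).1 ω‖) :=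
    fun ω => ⟨0, by rintro _ ⟨n, rfl⟩; exact norm_nonneg _⟩
  have hd0 : ∀ ω, 0 ≤ d ω := fun ω => le_ciInf fun n => norm_nonneg _
  have hdlim : ∀ᵐ ω ∂μ, Tendsto (fun n => ‖(w n).1 ω‖) atTop (𝓝 (d ω)) := by
    filter_upwards [ae_all_iff.2 hw] with ω h
    exact tendsto_atTop_ciInf (antitone_nat_of_succ_le h) (hbdd ω)
  have hdle : ∀ f ∈ K, ∀ᵐ ω ∂μ, d ω ≤ ‖f ω‖ := by
    intro f hf
    filter_upwards [ht _ ⟨⟨f, hf⟩, rfl⟩, hF ⟨f, hf⟩, ae_all_iff.2 hws,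
      ae_all_iff.2 fun n => hF (s n)] with ω h1 h2 h3 h4
    rw [h2] at h1
    have h5 : ⨆ n, (t n : Ω →ₘ[μ] EReal) ω ≤ ((-d ω : ℝ) : EReal) := iSup_le fun n => by
      rw [← hs n, h4 n, EReal.coe_le_coe_iff]
      exact neg_le_neg ((ciInf_le (hbdd ω) n).trans (h3 n))
    have := EReal.coe_le_coe_iff.1 (h1.trans h5)
    linarith
  -- Here and for segments towards `f`, only countably many pairs and weights are used, so the
  -- exceptional null sets can be united and the deterministic lemmas applied for each `ω`.
  have hmidle : ∀ n k, ∀ᵐ ω ∂μ,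
      d ω ≤ ‖(1 - (1 / 2 : ℝ)) • (w n).1 ω + (1 / 2 : ℝ) • (w k).1 ω‖ := by
    intro n k
    obtain ⟨h, hh, hω⟩ := hconv _ (w n).2 _ (w k).2 (1 / 2) (by norm_num) (by norm_num)
    filter_upwards [hω, hdle h hh] with ω h1 h2
    rwa [h1] at h2
  refine ⟨fun ω => limUnder atTop fun n => (w n).1 ω,
    @StronglyMeasurable.limUnder _ _ _ m _ _ _ _ _ _ _ fun n => hmeas _ (w n).2, fun f hf => ?_⟩
  have hsegle : ∀ n k : ℕ, ∀ᵐ ω ∂μ,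
      d ω ≤ ‖(1 - (1 / (k + 1 : ℝ))) • (w n).1 ω + (1 / (k + 1 : ℝ)) • f ω‖ := by
    intro n k
    obtain ⟨h, hh, hω⟩ := hconv _ (w n).2 _ hf (1 / (k + 1 : ℝ)) (by positivity)
      (by rw [div_le_one (by positivity)]; linarith [(Nat.cast_nonneg k : (0 : ℝ) ≤ k)])
    filter_upwards [hω, hdle h hh] with ω h1 h2
    rwa [h1] at h2
  filter_upwards [hdlim, ae_all_iff.2 fun n => ae_all_iff.2 (hmidle n),
    ae_all_iff.2 fun n => ae_all_iff.2 (hsegle n), he, ae_all_iff.2 fun n => heK _ (w n).2]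
    with ω h1 h2 h3 h4 h5 hω
  have hlim := (cauchySeq_of_midpoint_norm_ge (hd0 ω) h1 h2).tendsto_limUnder
  have hde : e ω ≤ d ω := le_ciInf fun n => h5 n hω
  have hdpos : 0 < d ω := (h4 hω).trans_le hde
  exact (pow_pos hdpos 2).trans_le (norm_sq_le_inner_of_segment (hd0 ω) h1 hlim h3)

end Separation

/-! ### From lower semicontinuity to avoidance almost everywhere on a piece. -/

section Neighbourhood

variable {Ω : Type*} {m m0 : MeasurableSpace Ω} {μ : Measure[m0] Ω} {φ ψ : ℝ≥0 → ℝ≥0∞}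
  {ρ : (Ω →ₘ[μ] ℝ) → (Ω →ₘ[μ] ℝ)}

/-- `Q` is finite, so the set is shrunk finitely often and keeps positive measure. -/
theorem exists_subset_forall_eq_of_mem_hull {D : Set (Ω →ₘ[μ] ℝ)} (Q : Finset (Ω →ₘ[μ] ℝ))
    (hQ : ∀ p ∈ Q, p ∈ hull m D) {B : Set Ω} (hBm : MeasurableSet[m] B) (hB : μ B ≠ 0) :
    ∃ B' ⊆ B, MeasurableSet[m] B' ∧ μ B' ≠ 0 ∧ ∃ q : (Ω →ₘ[μ] ℝ) → (Ω →ₘ[μ] ℝ),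
      ∀ p ∈ Q, q p ∈ D ∧ ∀ᵐ ω ∂μ, ω ∈ B' → p ω = q p ω := by
  classical
  induction Q using Finset.induction_on with
  | empty => exact ⟨B, subset_rfl, hBm, hB, id, by simp⟩
  | insert a s ha ih =>
    obtain ⟨B₁, h1, h2, h3, q, hq⟩ := ih fun p hp => hQ p (Finset.mem_insert_of_mem hp)
    obtain ⟨B₂, k1, k2, k3, a', ha', k4⟩ :=
      exists_subset_eq_of_mem_hull (hQ a (Finset.mem_insert_self _ _)) h2 h3
    refine ⟨B₂, k1.trans h1, k2, k3, fun p => if p = a then a' else q p, fun p hp => ?_⟩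
    by_cases hpa : p = a
    · subst hpa; simpa using ⟨ha', k4⟩
    · have := hq p ((Finset.mem_insert.1 hp).resolve_left hpa)
      simp only [hpa, if_false]
      refine ⟨this.1, ?_⟩
      filter_upwards [this.2] with ω h hω using h (k1 hω)

/-- If `c < ρ(x₀)` and `ρ̄` is weakly lower semicontinuous, then on a piece of positive measure of a
given set the sublevel set of `c` avoids a weak neighbourhood of `x₀` everywhere. -/
theorem exists_neighbourhood_avoiding_sublevel (hm : m ≤ m0) [IsFiniteMeasure μ] (hφ : Monotone φ)
    (hφ0 : φ 0 = 0) (hρ : IsCondConvexRiskMeasure m μ φ ψ ρ)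
    (hlsc : WeakLSC m μ (orliczModule m μ φ) (orliczModule m μ (conj φ)) (extension m φ ρ))
    {x₀ c : Ω →ₘ[μ] ℝ} (hx₀ : x₀ ∈ orlicz m0 μ φ) (hc : c ∈ L0 m μ)
    (hcρ : ∀ᵐ ω ∂μ, c ω < ρ x₀ ω) {B : Set Ω} (hBm : MeasurableSet[m] B) (hB : μ B ≠ 0) :
    ∃ D ⊆ B, MeasurableSet[m] D ∧ μ D ≠ 0 ∧ ∃ (Q : Finset (Ω →ₘ[μ] ℝ))
      (q : (Ω →ₘ[μ] ℝ) → (Ω →ₘ[μ] ℝ)), (∀ p ∈ Q, q p ∈ orlicz m0 μ (conj φ)) ∧ ∃ e ∈ L0pp m μ,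
        ∀ z ∈ orlicz m0 μ φ, (∀ᵐ ω ∂μ, ω ∈ D → ρ z ω ≤ c ω) →
          ∀ᵐ ω ∂μ, ω ∈ D → ∃ p ∈ Q, e ω < |condE m μ ((z - x₀) * q p) ω| := by
  have hloc := hρ.isLocalOn hm
  have hE := orliczModule_eq_hull (m := m) (μ := μ) hm hφ hφ0
  have hG := orliczModule_eq_hull (m := m) (μ := μ) hm (conj_mono φ) (conj_zero φ)
  rw [hE, hG] at hlsc
  have hx₀' : x₀ ∈ hull m (orlicz m0 μ φ) := subset_hull _ hx₀
  -- Off `B` the level is raised to `ρ x₀`, so that `x₀` itself is admissible there and the failure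
  -- of `ρ x₀ ≤ cB` is confined to `B`.
  obtain ⟨cB, hcB⟩ := exists_glue (hm _ hBm) c (ρ x₀)
  have hcBm : cB ∈ L0 m μ := mem_L0_of_glue hBm hc (hρ.mem_L0 hx₀) hcB
  have hext : extension m φ ρ x₀ = ρ x₀ := stableExt_eq hm hloc hx₀
  have hnot : ¬ extension m φ ρ x₀ ≤ cB := by
    rw [hext, ← AEEqFun.coeFn_le]
    intro h
    refine hB (measure_eq_zero_iff_ae_notMem.2 ?_)
    filter_upwards [h, hcB, hcρ] with ω h1 h2 h3 hω
    rw [h2.1 hω] at h1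
    exact absurd h1 (not_le.2 h3)
  obtain ⟨Q, hQ, e, he, hQe⟩ :=
    (hlsc cB hcBm).isOpen_compl ⟨x₀, hx₀'⟩ hnot
  have hmul : ∀ z ∈ hull m (orlicz m0 μ φ), ∀ p ∈ Q,
      (z - x₀) * p ∈ hull m {z : Ω →ₘ[μ] ℝ | Integrable z μ} := fun z hz p hp =>
    mul_mem_hull hφ (sub_mem_hull hφ hz hx₀') (hQ hp)
  -- The pieces of `B` on which some element meets both the sublevel and the neighbourhood
  -- condition. If countably many of them covered `B`, gluing their witnesses with `x₀` elsewhere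
  -- would give an element of the sublevel set of `cB` inside the neighbourhood, a contradiction.
  let S : Set (Set Ω) := {A | MeasurableSet[m] A ∧ A ⊆ B ∧ ∃ z ∈ orlicz m0 μ φ,
    (∀ p ∈ Q, ∀ᵐ ω ∂μ, ω ∈ A → |condEExt m μ ((z - x₀) * p) ω| ≤ e ω) ∧
      ∀ᵐ ω ∂μ, ω ∈ A → ρ z ω ≤ c ω}
  have hS : S.Nonempty := ⟨∅, @MeasurableSet.empty _ m, empty_subset _, x₀, hx₀, by simp, by simp⟩
  obtain ⟨A, hA, hAS⟩ := exists_seq_measure_diff_eq_zero (μ := μ) hS fun A hA => hm _ hA.1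
  choose hAm hAB z hz hzQ hzc using hA
  have hUm : MeasurableSet[m] (⋃ n, A n) := MeasurableSet.iUnion hAm
  have hD0 : μ (B \ ⋃ n, A n) ≠ 0 := by
    intro h0
    let A' : ℕ → Set Ω := fun n => Nat.casesOn n (⋃ n, A n)ᶜ (disjointed A)
    let xs : ℕ → (Ω →ₘ[μ] ℝ) := fun n => Nat.casesOn n x₀ z
    have hA' : IsPartition m A' := by
      refine ⟨fun n => ?_, fun i j hij => ?_, ?_⟩
      · cases n with
        | zero => exact hUm.compl
        | succ n => exact MeasurableSet.disjointed hAm n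
      · cases i with
        | zero =>
          cases j with
          | zero => exact absurd rfl hij
          | succ j =>
            exact disjoint_left.2 fun ω h1 h2 => h1 (mem_iUnion.2 ⟨j, disjointed_subset A j h2⟩)
        | succ i =>
          cases j with
          | zero =>
            exact disjoint_left.2 fun ω h1 h2 => h2 (mem_iUnion.2 ⟨i, disjointed_subset A i h1⟩)
          | succ j => exact disjoint_disjointed A (fun h => hij (by rw [h]))
      · refine iUnion_eq_univ_iff.2 fun ω => ?_
        by_cases hω : ω ∈ ⋃ n, A n
        · rw [← iUnion_disjointed] at hω
          obtain ⟨n, hn⟩ := mem_iUnion.1 hω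
          exact ⟨n + 1, hn⟩
        · exact ⟨0, hω⟩
    have hxs : ∀ k, xs k ∈ orlicz m0 μ φ := fun k => by cases k <;> simp [xs, hx₀, hz]
    obtain ⟨u, hu⟩ := exists_concat (fun k => hm _ (hA'.1 k)) hA'.2.1 xs
    have huh : u ∈ hull m (orlicz m0 μ φ) := ⟨A', xs, hA', hxs, hu⟩
    refine hQe ⟨u, huh⟩ (fun p hp => hA'.ae_of_forall fun k => ?_)
      (AEEqFun.coeFn_le.1 (hA'.ae_of_forall fun k => ?_))
    · have hcond := isLocalOn_stableExt hm (isLocalOn_condE hm) _ (hmul u huh p hp) _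
        (hmul (xs k) (subset_hull _ (hxs k)) p hp) (A' k) (hA'.1 k) (by
          filter_upwards [hu k, AEEqFun.coeFn_mul (u - x₀) p, AEEqFun.coeFn_mul (xs k - x₀) p,
            AEEqFun.coeFn_sub u x₀, AEEqFun.coeFn_sub (xs k) x₀] with ω h1 h2 h3 h4 h5 hω
          rw [h2, h3, Pi.mul_apply, Pi.mul_apply, h4, h5, Pi.sub_apply, Pi.sub_apply, h1 hω])
      cases k with
      | zero =>
        have hzero : (xs 0 - x₀) * p = 0 := by
          refine AEEqFun.ext ?_
          filter_upwards [AEEqFun.coeFn_mul (xs 0 - x₀) p, AEEqFun.coeFn_sub (xs 0) x₀,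
            AEEqFun.coeFn_zero (β := ℝ) (μ := μ)] with ω h1 h2 h3
          rw [h1, h3, Pi.mul_apply, h2]
          simp [xs]
        have hint : Integrable (0 : Ω →ₘ[μ] ℝ) μ :=
          (integrable_zero _ _ _).congr (AEEqFun.coeFn_zero (β := ℝ) (μ := μ)).symm
        have hval := condEExt_eq hm hint
        filter_upwards [hcond, he.2, coeFn_condE (m := m) (0 : Ω →ₘ[μ] ℝ),
          condExp_congr_ae (m := m) (AEEqFun.coeFn_zero (β := ℝ) (μ := μ))] with ω h1 h2 h3 h4 hω
        have h5 := h1 hω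
        rw [hzero] at h5
        change condEExt m μ ((u - x₀) * p) ω = condEExt m μ 0 ω at h5
        rw [h5, hval, h3, h4, condExp_zero]
        simpa using h2.le
      | succ k =>
        filter_upwards [hcond, hzQ k p hp] with ω h1 h2 hω
        have h5 := h1 hω
        change condEExt m μ ((u - x₀) * p) ω = condEExt m μ ((z k - x₀) * p) ω at h5
        rw [h5]
        exact h2 (disjointed_subset A k hω)
    · have hval := stableExt_eq_on hm hloc huh (hxs k) (hA'.1 k) (hu k)
      cases k with
      | zero =>
        filter_upwards [hval, hcB, measure_eq_zero_iff_ae_notMem.1 h0] with ω h1 h2 h3 hω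
        have hωB : ω ∉ B := fun h => h3 ⟨h, hω⟩
        rw [h2.2 hωB]
        exact (h1 hω).le
      | succ k =>
        filter_upwards [hval, hcB, hzc k] with ω h1 h2 h3 hω
        have hωA := disjointed_subset A k hω
        rw [h2.1 (hAB k hωA)]
        exact (h1 hω).le.trans (h3 hωA)
  -- On a piece of what remains, the module elements of `Q` coincide with Orlicz space elements, so
  -- the classical conditional expectation can be used.
  obtain ⟨D, hDsub, hDm, hD, q, hq⟩ :=
    exists_subset_forall_eq_of_mem_hull Q (fun p hp => hQ hp) (hBm.diff hUm) hD0
  refine ⟨D, hDsub.trans sdiff_subset, hDm, hD, Q, q, fun p hp => (hq p hp).1, e, he,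
    fun z hz hzc => ?_⟩
  obtain ⟨e', he', hee'⟩ := he.1
  -- The part of `D` where `z` stays within the neighbourhood. It belongs to `S`, yet is disjoint
  -- from the exhausting union, hence null.
  let N : Set Ω := D ∩ ⋂ p ∈ Q, {ω | |μ[fun ω => (z - x₀ : Ω →ₘ[μ] ℝ) ω * q p ω | m] ω| ≤ e' ω}
  have hNm : MeasurableSet[m] N := by
    refine hDm.inter (Finset.measurableSet_biInter _ fun p _ => ?_)
    simp_rw [← Real.norm_eq_abs]
    exact StronglyMeasurable.measurableSet_le stronglyMeasurable_condExp.norm he'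
  have hzx : z - x₀ ∈ orlicz m0 μ φ := sub_mem_orlicz hφ hz hx₀
  have hNS : N ∈ S := by
    refine ⟨hNm, fun ω hω => (hDsub hω.1).1, z, hz, fun p hp => ?_, ?_⟩
    · have := condEExt_eq_on hm (hmul z (subset_hull _ hz) p hp)
        (integrable_coeFn_mul hφ hzx (hq p hp).1) hNm (by
          filter_upwards [(hq p hp).2, AEEqFun.coeFn_mul (z - x₀) p,
            AEEqFun.coeFn_mul (z - x₀) (q p)] with ω h1 h2 h3 hω
          rw [h2, h3, Pi.mul_apply, Pi.mul_apply, h1 hω.1])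
      filter_upwards [this, coeFn_condE_mul (m := m) (z - x₀) (q p), hee'] with ω h1 h2 h3 hω
      rw [h1 hω, h2, h3]
      exact mem_iInter₂.1 hω.2 p hp
    · filter_upwards [hzc] with ω h hω using h hω.1
  have hN0 : μ N = 0 := by
    have := hAS N hNS
    rwa [sdiff_eq_left.2] at this
    exact disjoint_left.2 fun ω h1 h2 => (hDsub h1.1).2 h2
  have hcoe : ∀ᵐ ω ∂μ, ∀ p ∈ Q, condE m μ ((z - x₀) * q p) ω =
      μ[fun ω => (z - x₀ : Ω →ₘ[μ] ℝ) ω * q p ω | m] ω :=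
    (ae_ball_iff Q.countable_toSet).2 fun p _ => coeFn_condE_mul (m := m) (z - x₀) (q p)
  filter_upwards [measure_eq_zero_iff_ae_notMem.1 hN0, hcoe, hee'] with ω h1 h2 h3 hω
  by_contra! h
  refine h1 ⟨hω, mem_iInter₂.2 fun p hp => ?_⟩
  have := h p hp
  rw [h2 p hp, h3] at this
  exact this

end Neighbourhood

/-! ### A single separating dual element from finitely many pairings. -/

section SeparatingFunctional

variable {Ω : Type*} {m m0 : MeasurableSpace Ω} {μ : Measure[m0] Ω} {φ ψ : ℝ≥0 → ℝ≥0∞}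
  {ρ : (Ω →ₘ[μ] ℝ) → (Ω →ₘ[μ] ℝ)}

theorem exists_bounded_mul_mem_orlicz (hm : m ≤ m0) (hφ : Monotone φ) {q : Ω →ₘ[μ] ℝ}
    (hq : q ∈ orlicz m0 μ φ) {f : Ω → ℝ} (hf : StronglyMeasurable[m] f) (N : ℝ≥0)
    (hN : ∀ ω, |f ω| ≤ N) : ∃ r ∈ orlicz m0 μ φ, ∀ᵐ ω ∂μ, r ω = f ω * q ω := by
  have hr : AEStronglyMeasurable (fun ω => f ω * q ω) μ :=
    (hf.mono hm).aestronglyMeasurable.mul q.aestronglyMeasurable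
  refine ⟨AEEqFun.mk _ hr, mem_orlicz_of_le_max hφ hq hq (mem_L0_top _) N ?_,
    AEEqFun.coeFn_mk _ hr⟩
  filter_upwards [AEEqFun.coeFn_mk _ hr] with ω h
  rw [h, abs_mul, max_self]
  exact mul_le_mul_of_nonneg_right (hN ω) (abs_nonneg _)

theorem sum_mem_orlicz [IsFiniteMeasure μ] (hφ : Monotone φ) (h0 : ∃ t, 0 < t ∧ φ t < ∞)
    {ι : Type*} (s : Finset ι) (r : ι → (Ω →ₘ[μ] ℝ)) (hr : ∀ i ∈ s, r i ∈ orlicz m0 μ φ) :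
    ∑ i ∈ s, r i ∈ orlicz m0 μ φ := by
  classical
  induction s using Finset.induction_on with
  | empty =>
    refine mem_orlicz_of_bounded hφ h0 (mem_L0_top _) 0 ?_
    filter_upwards [AEEqFun.coeFn_zero (β := ℝ) (μ := μ)] with ω h
    simp [h]
  | insert a s ha ih =>
    rw [Finset.sum_insert ha]
    exact add_mem_orlicz hφ (hr a (Finset.mem_insert_self _ _))
      (ih fun i hi => hr i (Finset.mem_insert_of_mem hi))

/-- If the sublevel set of `c` avoids a weak neighbourhood of `x₀` everywhere on `D`, then a single
dual element separates it strictly from `x₀` on a piece of `D`. -/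
theorem exists_separating_dual (hm : m ≤ m0) [IsFiniteMeasure μ] (hφ : IsYoung φ)
    (hρ : IsCondConvexRiskMeasure m μ φ ψ ρ) {x₀ c z₀ : Ω →ₘ[μ] ℝ} (hx₀ : x₀ ∈ orlicz m0 μ φ)
    {D : Set Ω} (hDm : MeasurableSet[m] D) (hD : μ D ≠ 0) (hz₀ : z₀ ∈ orlicz m0 μ φ)
    (hz₀c : ∀ᵐ ω ∂μ, ω ∈ D → ρ z₀ ω ≤ c ω) {Q : Finset (Ω →ₘ[μ] ℝ)}
    {q : (Ω →ₘ[μ] ℝ) → (Ω →ₘ[μ] ℝ)} (hq : ∀ p ∈ Q, q p ∈ orlicz m0 μ (conj φ)) {e : Ω →ₘ[μ] ℝ}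
    (he : e ∈ L0pp m μ)
    (hsep : ∀ z ∈ orlicz m0 μ φ, (∀ᵐ ω ∂μ, ω ∈ D → ρ z ω ≤ c ω) →
      ∀ᵐ ω ∂μ, ω ∈ D → ∃ p ∈ Q, e ω < |condE m μ ((z - x₀) * q p) ω|) :
    ∃ D' ⊆ D, MeasurableSet[m] D' ∧ μ D' ≠ 0 ∧ ∃ y ∈ orlicz m0 μ (conj φ),
      ∀ z ∈ orlicz m0 μ φ, (∀ᵐ ω ∂μ, ω ∈ D → ρ z ω ≤ c ω) →
        ∀ᵐ ω ∂μ, ω ∈ D' → 0 < μ[fun ω => (z - x₀ : Ω →ₘ[μ] ℝ) ω * y ω | m] ω := by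
  classical
  have hφm := hφ.mono
  -- The neighbourhood condition only sees the finite vector `V z` of pairings, so separation takes
  -- place in a Euclidean space.
  let T : (Ω →ₘ[μ] ℝ) → Q → Ω → ℝ := fun z p => μ[fun ω => (z - x₀ : Ω →ₘ[μ] ℝ) ω * q p ω | m]
  let V : (Ω →ₘ[μ] ℝ) → Ω → EuclideanSpace ℝ Q := fun z ω => WithLp.toLp 2 fun p => T z p ω
  have hint : ∀ z ∈ orlicz m0 μ φ, ∀ p : Q,
      Integrable (fun ω => (z - x₀ : Ω →ₘ[μ] ℝ) ω * q p ω) μ := fun z hz p =>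
    integrable_mul_of_mem_orlicz hφm (sub_mem_orlicz hφm hz hx₀) (hq p p.2)
  have hVm : ∀ z, StronglyMeasurable[m] (V z) := fun z => by
    refine (PiLp.continuous_toLp 2 _).comp_stronglyMeasurable ?_
    refine Measurable.stronglyMeasurable (@measurable_pi_lambda _ _ _ m _ _ fun p => ?_)
    exact (stronglyMeasurable_condExp (m := m)).measurable
  let K : Set (Ω → EuclideanSpace ℝ Q) :=
    {f | ∃ z ∈ orlicz m0 μ φ, (∀ᵐ ω ∂μ, ω ∈ D → ρ z ω ≤ c ω) ∧ f = V z}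
  obtain ⟨v, hvm, hv⟩ := exists_stronglyMeasurable_inner_pos (μ := μ) (K := K) (D := D) (e := e) hm
    ⟨V z₀, z₀, hz₀, hz₀c, rfl⟩
    (by rintro _ ⟨z, -, -, rfl⟩; exact hVm z)
    (by
      rintro _ ⟨z, hz, hzc, rfl⟩ _ ⟨z', hz', hzc', rfl⟩ t ht0 ht1
      have hu : ∀ᵐ ω ∂μ, ((1 - t) • z + t • z' : Ω →ₘ[μ] ℝ) ω = (1 - t) * z ω + t * z' ω := by
        filter_upwards [AEEqFun.coeFn_add ((1 - t) • z) (t • z'), AEEqFun.coeFn_smul (1 - t) z,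
          AEEqFun.coeFn_smul t z'] with ω h1 h2 h3
        rw [h1, Pi.add_apply, h2, h3]; rfl
      have huo : (1 - t) • z + t • z' ∈ orlicz m0 μ φ := by
        refine mem_orlicz_of_le_max hφm hz hz' (mem_L0_top _) 1 ?_
        filter_upwards [hu] with ω h
        rw [h]
        have h1 := abs_add_le ((1 - t) * z ω) (t * z' ω)
        rw [abs_mul, abs_mul, abs_of_nonneg ht0, abs_of_nonneg (sub_nonneg.2 ht1)] at h1
        have h2 := mul_le_mul_of_nonneg_left (le_max_left |z ω| |z' ω|) (sub_nonneg.2 ht1)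
        have h3 := mul_le_mul_of_nonneg_left (le_max_right |z ω| |z' ω|) ht0
        push_cast
        linarith
      refine ⟨_, ⟨_, huo, ?_, rfl⟩, ?_⟩
      · filter_upwards [hρ.ae_le_of_convex hm hz hz' (l := fun _ => 1 - t)
          (@stronglyMeasurable_const _ _ m _ _) (fun _ => sub_nonneg.2 ht1) (fun _ => by linarith)
          (z := (1 - t) • z + t • z') (by filter_upwards [hu] with ω h; rw [h]; ring),
          hzc, hzc'] with ω h1 h2 h3 hω
        have h4 := mul_le_mul_of_nonneg_left (h2 hω) (sub_nonneg.2 ht1)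
        have h5 := mul_le_mul_of_nonneg_left (h3 hω) ht0
        linarith
      · have hT : ∀ p, ∀ᵐ ω ∂μ,
            T ((1 - t) • z + t • z') p ω = (1 - t) * T z p ω + t * T z' p ω := by
          intro p
          have h1 : (fun ω => ((1 - t) • z + t • z' - x₀ : Ω →ₘ[μ] ℝ) ω * q p ω) =ᵐ[μ]
              (1 - t) • (fun ω => (z - x₀ : Ω →ₘ[μ] ℝ) ω * q p ω) +
              t • (fun ω => (z' - x₀ : Ω →ₘ[μ] ℝ) ω * q p ω) := by
            filter_upwards [hu, AEEqFun.coeFn_sub ((1 - t) • z + t • z') x₀,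
              AEEqFun.coeFn_sub z x₀, AEEqFun.coeFn_sub z' x₀] with ω h1 h2 h3 h4
            simp only [Pi.add_apply, Pi.smul_apply, smul_eq_mul, h2, h3, h4, Pi.sub_apply]
            rw [h1]; ring
          filter_upwards [condExp_congr_ae (m := m) h1,
            condExp_add ((hint z hz p).smul (1 - t)) ((hint z' hz' p).smul t) m,
            condExp_smul (μ := μ) (1 - t) (fun ω => (z - x₀ : Ω →ₘ[μ] ℝ) ω * q p ω) m,
            condExp_smul (μ := μ) t (fun ω => (z' - x₀ : Ω →ₘ[μ] ℝ) ω * q p ω) m]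
            with ω h1 h2 h3 h4
          change μ[_ | m] ω = _
          rw [h1, h2, Pi.add_apply, h3, h4]
          rfl
        filter_upwards [ae_all_iff.2 hT] with ω h
        ext p
        simpa [V] using h p)
    (by
      rintro _ ⟨z, hz, hzc, rfl⟩ _ ⟨z', hz', hzc', rfl⟩ A hA
      obtain ⟨u, hu⟩ := exists_glue (hm _ hA) z z'
      have huo := mem_orlicz_of_glue hφm hz hz' hu
      have hloc := hρ.isLocalOn hm
      have hu1 : ∀ᵐ ω ∂μ, ω ∈ A → u ω = z ω := by filter_upwards [hu] with ω h using h.1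
      have hu2 : ∀ᵐ ω ∂μ, ω ∈ Aᶜ → u ω = z' ω := by filter_upwards [hu] with ω h using h.2
      refine ⟨_, ⟨u, huo, ?_, rfl⟩, ?_⟩
      · filter_upwards [hloc u huo z hz A hA hu1, hloc u huo z' hz' Aᶜ hA.compl hu2, hzc, hzc']
          with ω h1 h2 h3 h4 hω
        by_cases hωA : ω ∈ A
        · rw [h1 hωA]; exact h3 hω
        · rw [h2 hωA]; exact h4 hω
      · have hT : ∀ w ∈ orlicz m0 μ φ, ∀ B, MeasurableSet[m] B → (∀ᵐ ω ∂μ, ω ∈ B → u ω = w ω) →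
            ∀ p, ∀ᵐ ω ∂μ, ω ∈ B → T u p ω = T w p ω := by
          intro w hw B hB h p
          refine condExp_eq_on hm (hint u huo p) (hint w hw p) hB ?_
          filter_upwards [h, AEEqFun.coeFn_sub u x₀, AEEqFun.coeFn_sub w x₀] with ω h1 h2 h3 hω
          rw [h2, h3, Pi.sub_apply, Pi.sub_apply, h1 hω]
        filter_upwards [ae_all_iff.2 (hT z hz A hA hu1),
          ae_all_iff.2 (hT z' hz' Aᶜ hA.compl hu2)] with ω h1 h2
        refine ⟨fun hω => ?_, fun hω => ?_⟩
        · ext p; simpa [V] using h1 p hω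
        · ext p; simpa [V] using h2 p hω)
    (by filter_upwards [he.2] with ω h _ using h)
    (by
      rintro _ ⟨z, hz, hzc, rfl⟩
      filter_upwards [hsep z hz hzc, ae_all_iff.2 fun p : Q =>
        coeFn_condE_mul (m := m) (z - x₀) (q p)] with ω h1 h2 hω
      obtain ⟨p, hp, hpe⟩ := h1 hω
      rw [h2 ⟨p, hp⟩] at hpe
      refine hpe.le.trans ?_
      have := PiLp.norm_apply_le (V z ω) ⟨p, hp⟩
      simpa [V, T] using this)
  -- The coordinates of `v` are cut to a set where they are bounded: the combination `∑ v_p q_p`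
  -- then stays in the Orlicz space, and the coefficients can be pulled out of the conditional
  -- expectation.
  obtain ⟨D', hD'D, hD'm, hD', N, hN⟩ := exists_subset_bounded hDm hD hvm.norm
  have hvp : ∀ p : Q, StronglyMeasurable[m] (D'.indicator fun ω => v ω p) := fun p =>
    StronglyMeasurable.indicator ((PiLp.continuous_apply 2 _ p).comp_stronglyMeasurable hvm) hD'm
  have hvN : ∀ (p : Q) ω, |D'.indicator (fun ω => v ω p) ω| ≤ (N : ℝ≥0) := by
    intro p ω
    by_cases hω : ω ∈ D'
    · rw [indicator_of_mem hω]
      have h1 := PiLp.norm_apply_le (v ω) p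
      have h2 := hN ω hω
      rw [abs_norm] at h2
      simpa using h1.trans h2
    · simp [indicator_of_notMem hω]
  choose r hr hrv using fun p : Q =>
    exists_bounded_mul_mem_orlicz hm (conj_mono φ) (hq p p.2) (hvp p) N (hvN p)
  refine ⟨D', hD'D, hD'm, hD', ∑ p, r p,
    sum_mem_orlicz (conj_mono φ) hφ.conj_exists_pos_lt_top _ _ fun p _ => hr p,
    fun z hz hzc => ?_⟩
  have h1 : (fun ω => (z - x₀ : Ω →ₘ[μ] ℝ) ω * (∑ p, r p : Ω →ₘ[μ] ℝ) ω) =ᵐ[μ]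
      ∑ p : Q, (D'.indicator fun ω => v ω p) * fun ω => (z - x₀ : Ω →ₘ[μ] ℝ) ω * q p ω := by
    filter_upwards [AEEqFun.coeFn_fun_finsetSum Finset.univ r, ae_all_iff.2 hrv] with ω h1 h2
    rw [h1, Finset.mul_sum, Finset.sum_apply]
    refine Finset.sum_congr rfl fun p _ => ?_
    rw [h2 p, Pi.mul_apply]; ring
  have h2 : ∀ p : Q, μ[(D'.indicator fun ω => v ω p) *
      fun ω => (z - x₀ : Ω →ₘ[μ] ℝ) ω * q p ω | m] =ᵐ[μ] (D'.indicator fun ω => v ω p) * T z p :=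
    fun p => condExp_stronglyMeasurable_mul_of_bound hm (hvp p) (hint z hz p) N
      (ae_of_all _ fun ω => by simpa using hvN p ω)
  have h3 : ∀ p : Q, Integrable ((D'.indicator fun ω => v ω p) *
      fun ω => (z - x₀ : Ω →ₘ[μ] ℝ) ω * q p ω) μ := fun p =>
    (hint z hz p).bdd_mul ((hvp p).mono hm).aestronglyMeasurable (c := N)
      (ae_of_all _ fun ω => by simpa using hvN p ω)
  filter_upwards [condExp_congr_ae (m := m) h1, condExp_finsetSum (fun p _ => h3 p) m,
    ae_all_iff.2 h2, hv (V z) ⟨z, hz, hzc, rfl⟩] with ω k1 k2 k3 k4 hω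
  rw [k1, k2, Finset.sum_apply]
  have k5 := k4 (hD'D hω)
  rw [PiLp.inner_apply] at k5
  refine k5.trans_eq (Finset.sum_congr rfl fun p _ => ?_)
  rw [k3 p, Pi.mul_apply, indicator_of_mem hω]
  simp [V, mul_comm]

end SeparatingFunctional

/-! ### Sign and normalisation of the separating dual element. -/

section Normalisation

variable {Ω : Type*} {m m0 : MeasurableSpace Ω} {μ : Measure[m0] Ω} {φ ψ : ℝ≥0 → ℝ≥0∞}
  {ρ : (Ω →ₘ[μ] ℝ) → (Ω →ₘ[μ] ℝ)}

theorem ae_eq_zero_of_condExp_nonpos (hm : m ≤ m0) [IsFiniteMeasure μ] {g : Ω → ℝ}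
    (hg : Integrable g μ) {A : Set Ω} (hA : MeasurableSet[m] A)
    (h0 : ∀ᵐ ω ∂μ, ω ∈ A → 0 ≤ g ω) (h1 : ∀ᵐ ω ∂μ, ω ∈ A → μ[g | m] ω ≤ 0) :
    ∀ᵐ ω ∂μ, ω ∈ A → g ω = 0 := by
  have hA0 := hm _ hA
  have h0' : 0 ≤ᵐ[μ.restrict A] g := (ae_restrict_iff' hA0).2 h0
  have h2 : ∫ ω in A, g ω ∂μ = 0 := by
    refine le_antisymm ?_ (integral_nonneg_of_ae h0')
    rw [← setIntegral_condExp hm hg hA]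
    exact integral_nonpos_of_ae ((ae_restrict_iff' hA0).2 h1)
  exact (ae_restrict_iff' hA0).1
    ((setIntegral_eq_zero_iff_of_nonneg_ae h0' hg.integrableOn).1 h2)

/-- Shifting by cash brings `ρ(x)` to the level `c` on any `m`-measurable set where the distance to
this level is bounded. -/
theorem IsCondConvexRiskMeasure.exists_cash_shift (hm : m ≤ m0) [IsFiniteMeasure μ]
    (hφ : IsYoung φ) (hρ : IsCondConvexRiskMeasure m μ φ ψ ρ) {x : Ω →ₘ[μ] ℝ}
    (hx : x ∈ orlicz m0 μ φ) {c : Ω →ₘ[μ] ℝ} {A : Set Ω} (hA : MeasurableSet[m] A) {f : Ω → ℝ}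
    (hf : StronglyMeasurable[m] f) (hfρ : ∀ᵐ ω ∂μ, ρ x ω - c ω = f ω) (N : ℕ)
    (hN : ∀ ω ∈ A, |f ω| ≤ N) :
    ∃ z ∈ orlicz m0 μ φ, (∀ᵐ ω ∂μ, ω ∈ A → z ω = x ω + (ρ x ω - c ω)) ∧
      ∀ᵐ ω ∂μ, ω ∈ A → ρ z ω = c ω := by
  obtain ⟨h, hh, hhf⟩ := exists_class_of_stronglyMeasurable (μ := μ) hm
    (StronglyMeasurable.indicator hf hA)
  have hho : h ∈ orlicz m μ φ := by
    refine mem_orlicz_of_bounded hφ.mono hφ.exists_pos_lt_top hh N ?_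
    filter_upwards [hhf] with ω k
    rw [k]
    by_cases hω : ω ∈ A
    · rw [indicator_of_mem hω]; simpa using hN ω hω
    · simp [indicator_of_notMem hω]
  refine ⟨x + h, add_mem_orlicz hφ.mono hx (orlicz_mono_measurableSpace hho), ?_, ?_⟩
  · filter_upwards [AEEqFun.coeFn_add x h, hhf, hfρ] with ω k1 k2 k3 hω
    rw [k1, Pi.add_apply, k2, indicator_of_mem hω, k3]
  · rw [hρ.cash x hx h hho]
    filter_upwards [AEEqFun.coeFn_sub (ρ x) h, hhf, hfρ] with ω k1 k2 k3 hω
    rw [k1, Pi.sub_apply, k2, indicator_of_mem hω, ← k3]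
    ring

theorem one_mem_orlicz [IsFiniteMeasure μ] (hφ : Monotone φ)
    (h0 : ∃ t, 0 < t ∧ φ t < ∞) : (1 : Ω →ₘ[μ] ℝ) ∈ orlicz m0 μ φ := by
  refine mem_orlicz_of_bounded hφ h0 (mem_L0_top _) 1 ?_
  filter_upwards [AEEqFun.coeFn_one (β := ℝ) (μ := μ)] with ω h
  simp [h]

/-- Pair with the constant `1`, which lies in the Orlicz space of `φ`. -/
theorem integrable_of_mem_orlicz_conj [IsFiniteMeasure μ] (hφ : IsYoung φ) {y : Ω →ₘ[μ] ℝ}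
    (hy : y ∈ orlicz m0 μ (conj φ)) : Integrable y μ := by
  refine (integrable_mul_of_mem_orlicz hφ.mono
    (one_mem_orlicz hφ.mono hφ.exists_pos_lt_top) hy).congr ?_
  filter_upwards [AEEqFun.coeFn_one (β := ℝ) (μ := μ)] with ω h
  simp [h]

/-- A dual element separating `x₀` strictly from a sublevel set is positive and nondegenerate. -/
theorem nonneg_and_condExp_pos_of_separating (hm : m ≤ m0) [IsFiniteMeasure μ] (hφ : IsYoung φ)
    (hρ : IsCondConvexRiskMeasure m μ φ ψ ρ) {x₀ c z₀ y : Ω →ₘ[μ] ℝ} (hx₀ : x₀ ∈ orlicz m0 μ φ)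
    {D D' : Set Ω} (hD'm : MeasurableSet[m] D') (hz₀ : z₀ ∈ orlicz m0 μ φ)
    (hz₀c : ∀ᵐ ω ∂μ, ω ∈ D → ρ z₀ ω ≤ c ω) (hy : y ∈ orlicz m0 μ (conj φ))
    (hsep : ∀ z ∈ orlicz m0 μ φ, (∀ᵐ ω ∂μ, ω ∈ D → ρ z ω ≤ c ω) →
        ∀ᵐ ω ∂μ, ω ∈ D' → 0 < μ[fun ω => (z - x₀ : Ω →ₘ[μ] ℝ) ω * y ω | m] ω) :
    (∀ᵐ ω ∂μ, ω ∈ D' → 0 ≤ y ω) ∧ ∀ᵐ ω ∂μ, ω ∈ D' → 0 < μ[y | m] ω := by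
  have hφm := hφ.mono
  have hint0 : Integrable (fun ω => (z₀ - x₀ : Ω →ₘ[μ] ℝ) ω * y ω) μ :=
    integrable_mul_of_mem_orlicz hφm (sub_mem_orlicz hφm hz₀ hx₀) hy
  have hyint := integrable_of_mem_orlicz_conj hφ hy
  -- By monotonicity of `ρ`, adding `n 1_s` to `z₀` stays in the sublevel set. Separation for every
  -- `n` forces `E[1_s y | 𝓕] ≥ 0` on `D'`, although `1_s y ≤ 0`; so `y` has no negative part there.
  let s : Set Ω := {ω | y ω < 0}
  have hs : MeasurableSet s := measurableSet_lt y.measurable measurable_const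
  have hwm : AEStronglyMeasurable (s.indicator (1 : Ω → ℝ)) μ :=
    (measurable_one.indicator hs).aestronglyMeasurable
  obtain ⟨w, hw⟩ : ∃ w : Ω →ₘ[μ] ℝ, w =ᵐ[μ] s.indicator (1 : Ω → ℝ) :=
    ⟨AEEqFun.mk _ hwm, AEEqFun.coeFn_mk _ hwm⟩
  have hwo : w ∈ orlicz m0 μ φ := by
    refine mem_orlicz_of_bounded hφm hφ.exists_pos_lt_top (mem_L0_top _) 1 ?_
    filter_upwards [hw] with ω h
    rw [h]
    by_cases hω : ω ∈ s <;> simp [hω]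
  have hwint : Integrable (fun ω => w ω * y ω) μ := integrable_mul_of_mem_orlicz hφm hwo hy
  have hn : ∀ n : ℕ, ∀ᵐ ω ∂μ, ω ∈ D' → 0 < μ[fun ω => (z₀ - x₀ : Ω →ₘ[μ] ℝ) ω * y ω | m] ω +
      n * μ[fun ω => w ω * y ω | m] ω := by
    intro n
    have hu : ∀ᵐ ω ∂μ, (z₀ + (n : ℝ) • w : Ω →ₘ[μ] ℝ) ω = z₀ ω + n * w ω := by
      filter_upwards [AEEqFun.coeFn_add z₀ ((n : ℝ) • w), AEEqFun.coeFn_smul (n : ℝ) w] with ω h1 h2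
      rw [h1, Pi.add_apply, h2]; rfl
    have huo : z₀ + (n : ℝ) • w ∈ orlicz m0 μ φ := by
      refine add_mem_orlicz hφm hz₀ (mem_orlicz_of_le_max hφm hwo hwo (mem_L0_top _) n ?_)
      filter_upwards [AEEqFun.coeFn_smul (n : ℝ) w] with ω h
      rw [h, Pi.smul_apply, smul_eq_mul, abs_mul, max_self]
      simp
    have hle : z₀ ≤ z₀ + (n : ℝ) • w := by
      rw [← AEEqFun.coeFn_le]
      filter_upwards [hu, hw] with ω h1 h2
      rw [h1, h2]
      have : 0 ≤ s.indicator (1 : Ω → ℝ) ω := indicator_nonneg (fun _ _ => zero_le_one) ω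
      linarith [mul_nonneg (Nat.cast_nonneg n : (0 : ℝ) ≤ n) this]
    have hanti := AEEqFun.coeFn_le.2 (hρ.antitone _ hz₀ _ huo hle)
    have hpos := hsep _ huo (by
      filter_upwards [hanti, hz₀c] with ω h1 h2 hω using h1.trans (h2 hω))
    have heq : (fun ω => (z₀ + (n : ℝ) • w - x₀ : Ω →ₘ[μ] ℝ) ω * y ω) =ᵐ[μ]
        (fun ω => (z₀ - x₀ : Ω →ₘ[μ] ℝ) ω * y ω) + (n : ℝ) • fun ω => w ω * y ω := by
      filter_upwards [hu, AEEqFun.coeFn_sub (z₀ + (n : ℝ) • w) x₀, AEEqFun.coeFn_sub z₀ x₀]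
        with ω h1 h2 h3
      simp only [Pi.add_apply, Pi.smul_apply, smul_eq_mul, h2, h3, Pi.sub_apply]
      rw [h1]; ring
    filter_upwards [hpos, condExp_congr_ae (m := m) heq,
      condExp_add hint0 (hwint.smul (n : ℝ)) m,
      condExp_smul (μ := μ) (n : ℝ) (fun ω => w ω * y ω) m] with ω h1 h2 h3 h4 hω
    have h5 := h1 hω
    rw [h2, h3, Pi.add_apply, h4] at h5
    exact h5
  have hwy : ∀ᵐ ω ∂μ, ω ∈ D' → 0 ≤ μ[fun ω => w ω * y ω | m] ω := by
    filter_upwards [ae_all_iff.2 hn] with ω h hω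
    by_contra! hneg
    obtain ⟨n, hn⟩ := exists_nat_gt (μ[fun ω => (z₀ - x₀ : Ω →ₘ[μ] ℝ) ω * y ω | m] ω /
      (-μ[fun ω => w ω * y ω | m] ω))
    rw [div_lt_iff₀ (by linarith)] at hn
    have := h n hω
    linarith
  have hwneg : ∀ᵐ ω ∂μ, w ω * y ω ≤ 0 := by
    filter_upwards [hw] with ω h
    rw [h]
    by_cases hω : ω ∈ s
    · simpa [hω] using (show y ω < 0 from hω).le
    · simp [hω]
  have hy0 : ∀ᵐ ω ∂μ, ω ∈ D' → 0 ≤ y ω := by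
    have := ae_eq_zero_of_condExp_nonpos hm hwint.neg hD'm
      (by filter_upwards [hwneg] with ω h _; simpa using h)
      (by
        filter_upwards [hwy, condExp_neg (μ := μ) (fun ω => w ω * y ω) m] with ω h1 h2 hω
        rw [h2]; simpa using h1 hω)
    filter_upwards [this, hw] with ω h1 h2 hω
    by_contra! hneg
    have h3 := h1 hω
    rw [Pi.neg_apply, h2, indicator_of_mem (show ω ∈ s from hneg)] at h3
    simp only [Pi.one_apply, one_mul, neg_eq_zero] at h3
    exact hneg.ne h3
  refine ⟨hy0, ?_⟩
  -- On `A` the nonnegative `y` has nonpositive conditional expectation and so vanishes; this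
  -- contradicts the strict separation of `z₀`.
  let A : Set Ω := D' ∩ {ω | μ[y | m] ω ≤ 0}
  have hA : MeasurableSet[m] A :=
    hD'm.inter ((stronglyMeasurable_condExp (m := m) (μ := μ) (f := y)).measurable
      (measurableSet_Iic (a := (0 : ℝ))))
  have hyA := ae_eq_zero_of_condExp_nonpos hm hyint hA
    (by filter_upwards [hy0] with ω h hω using h hω.1) (ae_of_all _ fun ω hω => hω.2)
  have hzA := condExp_eq_on hm hint0 (integrable_zero Ω ℝ μ) hA (by
    filter_upwards [hyA] with ω h hω
    simp [h hω])
  filter_upwards [hzA, hsep z₀ hz₀ hz₀c] with ω h1 h2 hω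
  by_contra! hneg
  have h3 := h2 hω
  rw [h1 ⟨hω, hneg⟩] at h3
  have h4 : μ[fun _ : Ω => (0 : ℝ) | m] ω = 0 := congrFun condExp_zero ω
  exact absurd h4 h3.ne'

/-- A separating dual element, normalised, is feasible and its conjugate value is controlled by the
level `c`. -/
theorem exists_feasible_dual_of_separating (hm : m ≤ m0) [IsFiniteMeasure μ] (hφ : IsYoung φ)
    (hρ : IsCondConvexRiskMeasure m μ φ ψ ρ) {x₀ c z₀ y : Ω →ₘ[μ] ℝ} (hx₀ : x₀ ∈ orlicz m0 μ φ)
    (hc : c ∈ L0 m μ) {D D' : Set Ω} (hD'm : MeasurableSet[m] D')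
    (hD' : μ D' ≠ 0) (hz₀ : z₀ ∈ orlicz m0 μ φ)
    (hz₀c : ∀ᵐ ω ∂μ, ω ∈ D → ρ z₀ ω ≤ c ω) (hy : y ∈ orlicz m0 μ (conj φ))
    (hsep : ∀ z ∈ orlicz m0 μ φ, (∀ᵐ ω ∂μ, ω ∈ D → ρ z ω ≤ c ω) →
        ∀ᵐ ω ∂μ, ω ∈ D' → 0 < μ[fun ω => (z - x₀ : Ω →ₘ[μ] ℝ) ω * y ω | m] ω) :
    ∃ A ⊆ D', MeasurableSet[m] A ∧ μ A ≠ 0 ∧ ∃ η ∈ orlicz m0 μ (conj φ), condE m μ η = -1 ∧ η ≤ 0 ∧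
      ∀ x ∈ orlicz m0 μ φ, ∀ᵐ ω ∂μ, ω ∈ A →
        condE m μ (x * η) ω - ρ x ω ≤ condE m μ (x₀ * η) ω - c ω := by
  have hφm := hφ.mono
  have hloc := hρ.isLocalOn hm
  obtain ⟨hy0, hE0⟩ := nonneg_and_condExp_pos_of_separating hm hφ hρ hx₀ hD'm hz₀ hz₀c hy hsep
  have hyint := integrable_of_mem_orlicz_conj hφ hy
  have hEm : StronglyMeasurable[m] fun ω => (μ[y | m] ω)⁻¹ :=
    (Measurable.stronglyMeasurable (measurable_inv.comp stronglyMeasurable_condExp.measurable))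
  obtain ⟨A, hAD, hAm, hA, N, hN⟩ := exists_subset_bounded hD'm hD' hEm
  -- The factor that normalises the conditional expectation to `-1`, restricted to a set where it is
  -- bounded. Off `A` the dual element is filled with the constant `-1`, which is feasible.
  let s : Ω → ℝ := A.indicator fun ω => -(μ[y | m] ω)⁻¹
  have hs : StronglyMeasurable[m] s := StronglyMeasurable.indicator hEm.neg hAm
  have hsN : ∀ ω, |s ω| ≤ (N : ℝ≥0) := by
    intro ω
    by_cases hω : ω ∈ A
    · simp only [s, indicator_of_mem hω, abs_neg]
      simpa using hN ω hω
    · simp [s, indicator_of_notMem hω]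
  obtain ⟨r, hr, hrs⟩ := exists_bounded_mul_mem_orlicz hm (conj_mono φ) hy hs N hsN
  have hone : (-1 : Ω →ₘ[μ] ℝ) =ᵐ[μ] fun _ => -1 := by
    filter_upwards [AEEqFun.coeFn_neg (1 : Ω →ₘ[μ] ℝ), AEEqFun.coeFn_one (β := ℝ) (μ := μ)]
      with ω h1 h2
    rw [h1, Pi.neg_apply, h2]; rfl
  have honeo : (-1 : Ω →ₘ[μ] ℝ) ∈ orlicz m0 μ (conj φ) := by
    refine mem_orlicz_of_bounded (conj_mono φ) hφ.conj_exists_pos_lt_top (mem_L0_top _) 1 ?_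
    filter_upwards [hone] with ω h
    simp [h]
  obtain ⟨η, hη⟩ := exists_glue (hm _ hAm) r (-1)
  have hηo := mem_orlicz_of_glue (conj_mono φ) hr honeo hη
  have hηint := integrable_of_mem_orlicz_conj hφ hηo
  have hbd : ∀ {f : Ω → ℝ}, Integrable f μ → Integrable (s * f) μ := fun hf =>
    hf.bdd_mul (hs.mono hm).aestronglyMeasurable (c := N)
      (ae_of_all _ fun ω => by simpa using hsN ω)
  have hpull : ∀ {f : Ω → ℝ}, Integrable f μ → μ[s * f | m] =ᵐ[μ] s * μ[f | m] := fun hf =>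
    condExp_stronglyMeasurable_mul_of_bound hm hs hf N
      (ae_of_all _ fun ω => by simpa using hsN ω)
  refine ⟨A, hAD, hAm, hA, η, hηo, ?_, ?_, fun x hx => ?_⟩
  · refine AEEqFun.ext ?_
    have h1 := condExp_eq_on hm hηint (hbd hyint) hAm (by
      filter_upwards [hη, hrs] with ω h1 h2 hω
      rw [h1.1 hω, h2]; rfl)
    have h2 := condExp_eq_on hm hηint (integrable_const (-1 : ℝ)) hAm.compl (by
      filter_upwards [hη, hone] with ω h1 h2 hω
      rw [h1.2 hω, h2])
    filter_upwards [h1, h2, hpull hyint, coeFn_condE (m := m) η, hone, hE0] with ω h1 h2 h3 h4 h5 h6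
    rw [h4, h5]
    by_cases hω : ω ∈ A
    · rw [h1 hω, h3, Pi.mul_apply]
      simp only [s, indicator_of_mem hω]
      have := (h6 (hAD hω)).ne'
      field_simp
    · rw [h2 hω, condExp_const hm]
  · rw [← AEEqFun.coeFn_le]
    filter_upwards [hη, hrs, hone, hy0, hE0, AEEqFun.coeFn_zero (β := ℝ) (μ := μ)]
      with ω h1 h2 h3 h4 h5 h6
    rw [h6]
    by_cases hω : ω ∈ A
    · rw [h1.1 hω, h2]
      simp only [s, indicator_of_mem hω]
      have k1 := h4 (hAD hω)
      have k2 := inv_pos.2 (h5 (hAD hω))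
      simp only [Pi.zero_apply, neg_mul, Left.neg_nonpos_iff]
      positivity
    · rw [h1.2 hω, h3]; norm_num
  · have hP : ∀ u ∈ orlicz m0 μ φ, ∀ᵐ ω ∂μ, ω ∈ A → condE m μ (u * η) ω =
        -(μ[y | m] ω)⁻¹ * μ[fun ω => u ω * y ω | m] ω := by
      intro u hu
      have huy := integrable_mul_of_mem_orlicz hφm hu hy
      have h1 := condExp_eq_on hm (integrable_mul_of_mem_orlicz hφm hu hηo) (hbd huy) hAm (by
        filter_upwards [hη, hrs] with ω h1 h2 hω
        rw [h1.1 hω, h2, Pi.mul_apply]; ring)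
      filter_upwards [h1, hpull huy, coeFn_condE_mul (m := m) u η] with ω h1 h2 h3 hω
      rw [h3, h1 hω, h2, Pi.mul_apply]
      simp only [s, indicator_of_mem hω]
    obtain ⟨c', hc', hcc'⟩ := hc
    obtain ⟨ρ', hρ', hρρ'⟩ := hρ.mem_L0 hx
    let f : Ω → ℝ := fun ω => ρ' ω - c' ω
    have hf : StronglyMeasurable[m] f := hρ'.sub hc'
    have hfρ : ∀ᵐ ω ∂μ, ρ x ω - c ω = f ω := by
      filter_upwards [hcc', hρρ'] with ω h1 h2
      rw [h1, h2]
    -- Cash invariance is available only for amounts in `L^φ(𝓕)`, so the argument is localised to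
    -- where `|ρ x - c| ≤ j`. There `x + (ρ x - c)` lies exactly at level `c`; `z₀` completes it to
    -- a competitor on all of `D`.
    have key : ∀ j : ℕ, ∀ᵐ ω ∂μ, ω ∈ A → |f ω| ≤ j →
        condE m μ (x * η) ω - ρ x ω ≤ condE m μ (x₀ * η) ω - c ω := by
      intro j
      let B : Set Ω := A ∩ {ω | |f ω| ≤ j}
      have hB : MeasurableSet[m] B := hAm.inter
        ((measurable_norm.comp hf.measurable) (measurableSet_Iic (a := (j : ℝ))))
      obtain ⟨z, hz, hzx, hzc⟩ := hρ.exists_cash_shift hm hφ hx hB hf hfρ j fun ω hω => hω.2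
      obtain ⟨u, hu⟩ := exists_glue (hm _ hB) z z₀
      have huo := mem_orlicz_of_glue hφm hz hz₀ hu
      have hu1 : ∀ᵐ ω ∂μ, ω ∈ B → u ω = z ω := by filter_upwards [hu] with ω h using h.1
      have hu2 : ∀ᵐ ω ∂μ, ω ∈ Bᶜ → u ω = z₀ ω := by filter_upwards [hu] with ω h using h.2
      have hpos := hsep u huo (by
        filter_upwards [hloc u huo z hz B hB hu1, hloc u huo z₀ hz₀ Bᶜ hB.compl hu2, hz₀c, hzc]
          with ω h1 h2 h3 h4 hω
        by_cases hωB : ω ∈ B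
        · rw [h1 hωB, h4 hωB]
        · rw [h2 hωB]; exact h3 hω)
      let b : Ω → ℝ := B.indicator f
      have hb : StronglyMeasurable[m] b := StronglyMeasurable.indicator hf hB
      have hbj : ∀ ω, ‖b ω‖ ≤ j := by
        intro ω
        by_cases hω : ω ∈ B
        · simp only [b, indicator_of_mem hω]; exact hω.2
        · simp [b, indicator_of_notMem hω]
      have hxy := integrable_mul_of_mem_orlicz hφm hx hy
      have hx₀y := integrable_mul_of_mem_orlicz hφm hx₀ hy
      have hby : Integrable (b * ⇑y) μ := hyint.bdd_mul (hb.mono hm).aestronglyMeasurable (c := j)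
        (ae_of_all _ hbj)
      have hval := condExp_eq_on hm
        (integrable_mul_of_mem_orlicz hφm (sub_mem_orlicz hφm huo hx₀) hy)
        ((hxy.add hby).sub hx₀y) hB (by
          filter_upwards [hu1, hzx, AEEqFun.coeFn_sub u x₀, hfρ] with ω h1 h2 h3 h4 hω
          rw [h3, Pi.sub_apply, h1 hω, h2 hω, h4]
          simp only [Pi.sub_apply, Pi.add_apply, Pi.mul_apply, b, indicator_of_mem hω]
          ring)
      filter_upwards [hpos, hval, condExp_sub (hxy.add hby) hx₀y m, condExp_add hxy hby m,
        condExp_stronglyMeasurable_mul_of_bound hm hb hyint j (ae_of_all _ hbj), hP x hx,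
        hP x₀ hx₀, hE0, hfρ] with ω h1 h2 h3 h4 h5 h6 h7 h8 h9 hωA hωj
      have hωB : ω ∈ B := ⟨hωA, hωj⟩
      have k1 := h1 (hAD hωA)
      rw [h2 hωB, h3, Pi.sub_apply, h4, Pi.add_apply, h5, Pi.mul_apply] at k1
      simp only [b, indicator_of_mem hωB] at k1
      rw [← h9] at k1
      rw [h6 hωA, h7 hωA]
      have k2 := h8 (hAD hωA)
      -- Dividing the separation inequality by `E[y | 𝓕]` isolates the cash amount `ρ x - c`.
      have k3 := mul_pos (inv_pos.2 k2) k1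
      have k4 : (μ[y | m] ω)⁻¹ * ((ρ x ω - c ω) * μ[y | m] ω) = ρ x ω - c ω := by
        field_simp
      rw [mul_sub, mul_add, k4] at k3
      linarith
    filter_upwards [ae_all_iff.2 key] with ω h hω
    obtain ⟨j, hj⟩ := exists_nat_ge |f ω|
    exact h j hω hj

end Normalisation

/-! ### Dual representations and the three implications. -/

section Duality

variable {Ω : Type*} {m m0 : MeasurableSpace Ω} {μ : Measure[m0] Ω} {φ ψ : ℝ≥0 → ℝ≥0∞}
  {ρ : (Ω →ₘ[μ] ℝ) → (Ω →ₘ[μ] ℝ)}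

theorem coeFn_toE (x : Ω →ₘ[μ] ℝ) : toE x =ᵐ[μ] fun ω => (x ω : EReal) :=
  AEEqFun.coeFn_comp _ _ _

theorem coeFn_subE (x : Ω →ₘ[μ] ℝ) (g : Ω →ₘ[μ] EReal) :
    subE x g =ᵐ[μ] fun ω => (x ω : EReal) - g ω := by
  filter_upwards [AEEqFun.coeFn_comp₂Measurable (fun a b : EReal => a - b) measurable_ereal_sub
    (toE x) g, coeFn_toE x] with ω h1 h2
  rw [← h2]; exact h1

theorem toE_le_toE {x y : Ω →ₘ[μ] ℝ} : toE x ≤ toE y ↔ x ≤ y := by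
  rw [← AEEqFun.coeFn_le, ← AEEqFun.coeFn_le]
  constructor <;> intro h <;> filter_upwards [h, coeFn_toE x, coeFn_toE y] with ω h1 h2 h3
  · rwa [h2, h3, EReal.coe_le_coe_iff] at h1
  · rwa [h2, h3, EReal.coe_le_coe_iff]

/-- Setting `b` to `⊤` off `A` gives a global upper bound, so least upper bounds can be compared on
one piece. -/
theorem esssup_le_on [IsFiniteMeasure μ] {C : Set (Ω →ₘ[μ] EReal)} {A : Set Ω}
    (hA : MeasurableSet A) (b : Ω →ₘ[μ] EReal) (h : ∀ g ∈ C, ∀ᵐ ω ∂μ, ω ∈ A → g ω ≤ b ω) :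
    ∀ᵐ ω ∂μ, ω ∈ A → esssup C ω ≤ b ω := by
  classical
  have hf : Measurable (A.piecewise b fun _ => ⊤) := b.measurable.piecewise hA measurable_const
  have hle : esssup C ≤ AEEqFun.mk _ hf.aestronglyMeasurable := by
    refine (isLUB_esssup C).2 fun g hg => ?_
    rw [← AEEqFun.coeFn_le]
    filter_upwards [h g hg, AEEqFun.coeFn_mk _ hf.aestronglyMeasurable] with ω h1 h2
    rw [h2]
    by_cases hω : ω ∈ A
    · rw [piecewise_eq_of_mem _ _ _ hω]; exact h1 hω
    · rw [piecewise_eq_of_notMem _ _ _ hω]; exact le_top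
  filter_upwards [AEEqFun.coeFn_le.2 hle, AEEqFun.coeFn_mk _ hf.aestronglyMeasurable]
    with ω h1 h2 hω
  rwa [h2, piecewise_eq_of_mem _ _ _ hω] at h1

theorem ereal_sub_le_of_coe_sub_le {a r : ℝ} {F : EReal} (h : ((a - r : ℝ) : EReal) ≤ F) :
    (a : EReal) - F ≤ r := by
  refine (EReal.sub_le_sub le_rfl h).trans ?_
  rw [← EReal.coe_sub, sub_sub_cancel]

theorem le_ereal_sub_of_le_coe_sub {a r : ℝ} {F : EReal} (h : F ≤ ((a - r : ℝ) : EReal)) :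
    (r : EReal) ≤ (a : EReal) - F := by
  refine le_trans ?_ (EReal.sub_le_sub le_rfl h)
  rw [← EReal.coe_sub, sub_sub_cancel]

theorem coe_sub_le_fenchel [IsFiniteMeasure μ] {x : Ω →ₘ[μ] ℝ} (hx : x ∈ orlicz m0 μ φ)
    (y : Ω →ₘ[μ] ℝ) :
    ∀ᵐ ω ∂μ, ((condE m μ (x * y) ω - ρ x ω : ℝ) : EReal) ≤ fenchel m φ ρ y ω := by
  have h := AEEqFun.coeFn_le.2 ((isLUB_esssup {g | ∃ x ∈ orlicz m0 μ φ,
    g = toE (condE m μ (x * y) - ρ x)}).1 ⟨x, hx, rfl⟩)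
  filter_upwards [h, coeFn_toE (condE m μ (x * y) - ρ x),
    AEEqFun.coeFn_sub (condE m μ (x * y)) (ρ x)] with ω h1 h2 h3
  rw [h2, h3] at h1
  exact h1

theorem coe_sub_le_fenchelModule [IsFiniteMeasure μ] {f : (Ω →ₘ[μ] ℝ) → (Ω →ₘ[μ] ℝ)}
    {x : Ω →ₘ[μ] ℝ} (hx : x ∈ orliczModule m μ φ) (y : Ω →ₘ[μ] ℝ) :
    ∀ᵐ ω ∂μ, ((condEExt m μ (x * y) ω - f x ω : ℝ) : EReal) ≤ fenchelModule m φ f y ω := by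
  have h := AEEqFun.coeFn_le.2 ((isLUB_esssup {g | ∃ x ∈ orliczModule m μ φ,
    g = toE (condEExt m μ (x * y) - f x)}).1 ⟨x, hx, rfl⟩)
  filter_upwards [h, coeFn_toE (condEExt m μ (x * y) - f x),
    AEEqFun.coeFn_sub (condEExt m μ (x * y)) (f x)] with ω h1 h2 h3
  rw [h2, h3] at h1
  exact h1

theorem exists_feasible_dual (hm : m ≤ m0) [IsFiniteMeasure μ] (hφ : IsYoung φ)
    (hρ : IsCondConvexRiskMeasure m μ φ ψ ρ)
    (hlsc : WeakLSC m μ (orliczModule m μ φ) (orliczModule m μ (conj φ)) (extension m φ ρ))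
    {x₀ c : Ω →ₘ[μ] ℝ} (hx₀ : x₀ ∈ orlicz m0 μ φ) (hc : c ∈ L0 m μ)
    (hcρ : ∀ᵐ ω ∂μ, c ω < ρ x₀ ω) {B : Set Ω} (hBm : MeasurableSet[m] B) (hB : μ B ≠ 0) :
    ∃ A ⊆ B, MeasurableSet[m] A ∧ μ A ≠ 0 ∧ ∃ y ∈ orlicz m0 μ (conj φ), condE m μ y = -1 ∧ y ≤ 0 ∧
      ∀ x ∈ orlicz m0 μ φ, ∀ᵐ ω ∂μ, ω ∈ A →
        condE m μ (x * y) ω - ρ x ω ≤ condE m μ (x₀ * y) ω - c ω := by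
  obtain ⟨c', hc', hcc'⟩ := id hc
  obtain ⟨ρ', hρ', hρρ'⟩ := hρ.mem_L0 hx₀
  have hfρ : ∀ᵐ ω ∂μ, ρ x₀ ω - c ω = (ρ' - c') ω := by
    filter_upwards [hcc', hρρ'] with ω h1 h2
    rw [h1, h2]; rfl
  -- Separation needs a nonempty sublevel set; a cash shift of `x₀` supplies `z₀` where `ρ x₀ - c`
  -- is bounded.
  obtain ⟨B', hB'B, hB'm, hB', N, hN⟩ := exists_subset_bounded hBm hB (hρ'.sub hc')
  obtain ⟨z₀, hz₀, -, hz₀c⟩ := hρ.exists_cash_shift hm hφ hx₀ hB'm (hρ'.sub hc') hfρ N hN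
  obtain ⟨D, hDB, hDm, hD, Q, q, hq, e, he, hsep⟩ :=
    exists_neighbourhood_avoiding_sublevel hm hφ.mono hφ.map_zero hρ hlsc hx₀ hc hcρ hB'm hB'
  have hz₀D : ∀ᵐ ω ∂μ, ω ∈ D → ρ z₀ ω ≤ c ω := by
    filter_upwards [hz₀c] with ω h hω using (h (hDB hω)).le
  obtain ⟨D', hD'D, hD'm, hD', y, hy, hysep⟩ :=
    exists_separating_dual hm hφ hρ hx₀ hDm hD hz₀ hz₀D hq he hsep
  obtain ⟨A, hAD, hAm, hA, h⟩ :=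
    exists_feasible_dual_of_separating hm hφ hρ hx₀ hc hD'm hD' hz₀ hz₀D hy hysep
  exact ⟨A, hAD.trans (hD'D.trans (hDB.trans hB'B)), hAm, hA, h⟩

/-- Lower semicontinuity of the stable extension yields the dual representation of `ρ`. -/
theorem representation_of_weakLSC (hm : m ≤ m0) [IsFiniteMeasure μ] (hφ : IsYoung φ)
    (hρ : IsCondConvexRiskMeasure m μ φ ψ ρ)
    (hlsc : WeakLSC m μ (orliczModule m μ φ) (orliczModule m μ (conj φ)) (extension m φ ρ))
    {x : Ω →ₘ[μ] ℝ} (hx : x ∈ orlicz m0 μ φ) :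
    toE (ρ x) = esssup {g | ∃ y ∈ orlicz m0 μ (conj φ), condE m μ y = -1 ∧ y ≤ 0 ∧
      g = subE (condE m μ (x * y)) (fenchel m φ ρ y)} := by
  set C := {g | ∃ y ∈ orlicz m0 μ (conj φ), condE m μ y = -1 ∧ y ≤ 0 ∧
      g = subE (condE m μ (x * y)) (fenchel m φ ρ y)} with hC
  refine le_antisymm ?_ ((isLUB_esssup C).2 ?_)
  swap
  · rintro _ ⟨y, hy, -, -, rfl⟩
    rw [← AEEqFun.coeFn_le]
    filter_upwards [coeFn_subE (condE m μ (x * y)) (fenchel m φ ρ y), coeFn_toE (ρ x),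
      coe_sub_le_fenchel (m := m) (ρ := ρ) hx y] with ω h1 h2 h3
    rw [h1, h2]
    exact ereal_sub_le_of_coe_sub_le h3
  have key : ∀ c ∈ L0 m μ, (∀ᵐ ω ∂μ, c ω < ρ x ω) → ∀ᵐ ω ∂μ, (c ω : EReal) ≤ esssup C ω := by
    intro c hc hcρ
    -- Sets on which a single feasible dual element certifies the level `c`. Every nonnull
    -- `𝓕`-measurable set contains a nonnull one, so countably many cover `Ω` almost surely.
    let S : Set (Set Ω) := {A | MeasurableSet[m] A ∧ ∃ y ∈ orlicz m0 μ (conj φ),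
      condE m μ y = -1 ∧ y ≤ 0 ∧ ∀ u ∈ orlicz m0 μ φ, ∀ᵐ ω ∂μ, ω ∈ A →
        condE m μ (u * y) ω - ρ u ω ≤ condE m μ (x * y) ω - c ω}
    by_cases hμ : μ univ = 0
    · filter_upwards [measure_eq_zero_iff_ae_notMem.1 hμ] with ω h using absurd (mem_univ ω) h
    have hS : S.Nonempty := by
      obtain ⟨A, -, hAm, -, h⟩ :=
        exists_feasible_dual hm hφ hρ hlsc hx hc hcρ (@MeasurableSet.univ _ m) hμ
      exact ⟨A, hAm, h⟩
    obtain ⟨A, hA, hAS⟩ := exists_seq_measure_diff_eq_zero (μ := μ) hS fun A hA => hm _ hA.1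
    have hUm : MeasurableSet[m] (⋃ n, A n) := MeasurableSet.iUnion fun n => (hA n).1
    have hU : μ (⋃ n, A n)ᶜ = 0 := by
      by_contra h0
      obtain ⟨D, hD, hDm, hD0, h⟩ := exists_feasible_dual hm hφ hρ hlsc hx hc hcρ hUm.compl h0
      have := hAS D ⟨hDm, h⟩
      rw [sdiff_eq_left.2 (disjoint_left.2 fun ω h1 h2 => hD h1 h2)] at this
      exact hD0 this
    have hn : ∀ n, ∀ᵐ ω ∂μ, ω ∈ A n → (c ω : EReal) ≤ esssup C ω := by
      intro n
      obtain ⟨hAm, y, hy, hy1, hy0, hyA⟩ := hA n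
      have hF : ∀ᵐ ω ∂μ, ω ∈ A n → fenchel m φ ρ y ω ≤ toE (condE m μ (x * y) - c) ω := by
        refine esssup_le_on (hm _ hAm) _ ?_
        rintro _ ⟨u, hu, rfl⟩
        filter_upwards [hyA u hu, coeFn_toE (condE m μ (u * y) - ρ u),
          coeFn_toE (condE m μ (x * y) - c), AEEqFun.coeFn_sub (condE m μ (u * y)) (ρ u),
          AEEqFun.coeFn_sub (condE m μ (x * y)) c] with ω h1 h2 h3 h4 h5 hω
        rw [h2, h3, h4, h5, EReal.coe_le_coe_iff]
        exact h1 hω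
      have hle := AEEqFun.coeFn_le.2 ((isLUB_esssup C).1 ⟨y, hy, hy1, hy0, rfl⟩)
      filter_upwards [hF, hle, coeFn_subE (condE m μ (x * y)) (fenchel m φ ρ y),
        coeFn_toE (condE m μ (x * y) - c),
        AEEqFun.coeFn_sub (condE m μ (x * y)) c] with ω h1 h2 h3 h4 h5 hω
      refine le_trans ?_ h2
      rw [h3]
      have h6 := h1 hω
      rw [h4, h5] at h6
      exact le_ereal_sub_of_le_coe_sub h6
    filter_upwards [ae_all_iff.2 hn, measure_eq_zero_iff_ae_notMem.1 hU] with ω h1 h2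
    obtain ⟨n, hn⟩ := mem_iUnion.1 (not_not.1 h2)
    exact h1 n hn
  obtain ⟨ρ', hρ', hρρ'⟩ := hρ.mem_L0 hx
  have hn : ∀ n : ℕ, ∀ᵐ ω ∂μ, ((ρ x ω - 1 / (n + 1 : ℝ) : ℝ) : EReal) ≤ esssup C ω := by
    intro n
    obtain ⟨c, hc, hcf⟩ := exists_class_of_stronglyMeasurable (μ := μ) hm
      (hρ'.sub (@stronglyMeasurable_const _ _ m _ (1 / (n + 1 : ℝ))))
    have hcρ : ∀ᵐ ω ∂μ, c ω = ρ x ω - 1 / (n + 1 : ℝ) := by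
      filter_upwards [hcf, hρρ'] with ω h1 h2
      rw [h1, h2]; rfl
    filter_upwards [hcρ, key c hc (by
      filter_upwards [hcρ] with ω h
      rw [h]; exact sub_lt_self _ (by positivity))] with ω h1 h2
    rwa [h1] at h2
  rw [← AEEqFun.coeFn_le]
  filter_upwards [ae_all_iff.2 hn, coeFn_toE (ρ x)] with ω h1 h2
  rw [h2]
  have hlim : Tendsto (fun n : ℕ => ((ρ x ω - 1 / (n + 1 : ℝ) : ℝ) : EReal)) atTop
      (𝓝 ((ρ x ω - 0 : ℝ) : EReal)) :=
    (continuous_coe_real_ereal.tendsto _).comp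
      (tendsto_one_div_add_atTop_nhds_zero_nat.const_sub _)
  rw [sub_zero] at hlim
  exact le_of_tendsto' hlim h1

/-- On each piece of a decomposition of `x`, both the pairing and the extension reduce to an Orlicz
space element. This direction suffices below: a smaller conjugate only raises the penalised value.
-/
theorem fenchelModule_extension_le_fenchel (hm : m ≤ m0) [IsFiniteMeasure μ] (hφ : IsYoung φ)
    {y : Ω →ₘ[μ] ℝ} (hy : y ∈ orlicz m0 μ (conj φ)) :
    fenchelModule m φ (extension m φ ρ) y ≤ fenchel m φ ρ y := by
  refine (isLUB_esssup _).2 ?_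
  rintro _ ⟨x, hx, rfl⟩
  rw [orliczModule_eq_hull hm hφ.mono hφ.map_zero] at hx
  obtain ⟨A, xs, hA, hxs, hAx, hAρ⟩ := stableExt_spec (f := ρ) hm hx
  rw [← AEEqFun.coeFn_le]
  refine hA.ae_of_forall fun k => ?_
  have hE := condEExt_eq_on hm (mul_mem_hull hφ.mono hx (subset_hull _ hy))
    (integrable_coeFn_mul hφ.mono (hxs k) hy) (hA.1 k) (by
      filter_upwards [hAx k, AEEqFun.coeFn_mul x y, AEEqFun.coeFn_mul (xs k) y] with ω h1 h2 h3 hω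
      rw [h2, h3, Pi.mul_apply, Pi.mul_apply, h1 hω])
  filter_upwards [hE, hAρ k, coe_sub_le_fenchel (m := m) (ρ := ρ) (hxs k) y,
    coeFn_toE (condEExt m μ (x * y) - extension m φ ρ x),
    AEEqFun.coeFn_sub (condEExt m μ (x * y)) (extension m φ ρ x)] with ω h1 h2 h3 h4 h5 hω
  rw [h4, h5, Pi.sub_apply, h1 hω]
  change ((_ - stableExt m (orlicz m0 μ φ) ρ x ω : ℝ) : EReal) ≤ _
  rw [h2 hω]
  exact h3

/-- The dual representation of `ρ` extends to the stable extension. -/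
theorem extension_representation (hm : m ≤ m0) [IsFiniteMeasure μ] (hφ : IsYoung φ)
    (hrep : ∀ x ∈ orlicz m0 μ φ, toE (ρ x) =
      esssup {g | ∃ y ∈ orlicz m0 μ (conj φ), condE m μ y = -1 ∧ y ≤ 0 ∧
        g = subE (condE m μ (x * y)) (fenchel m φ ρ y)})
    {x : Ω →ₘ[μ] ℝ} (hx : x ∈ orliczModule m μ φ) :
    toE (extension m φ ρ x) =
      esssup {g | ∃ y ∈ orliczModule m μ (conj φ), condEExt m μ y = -1 ∧ y ≤ 0 ∧
        g = subE (condEExt m μ (x * y)) (fenchelModule m φ (extension m φ ρ) y)} := by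
  set C := {g | ∃ y ∈ orliczModule m μ (conj φ), condEExt m μ y = -1 ∧ y ≤ 0 ∧
        g = subE (condEExt m μ (x * y)) (fenchelModule m φ (extension m φ ρ) y)} with hC
  refine le_antisymm ?_ ((isLUB_esssup C).2 ?_)
  swap
  · rintro _ ⟨y, hy, -, -, rfl⟩
    rw [← AEEqFun.coeFn_le]
    filter_upwards [coeFn_subE (condEExt m μ (x * y)) (fenchelModule m φ (extension m φ ρ) y),
      coeFn_toE (extension m φ ρ x),
      coe_sub_le_fenchelModule (f := extension m φ ρ) hx y] with ω h1 h2 h3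
    rw [h1, h2]
    exact ereal_sub_le_of_coe_sub_le h3
  rw [orliczModule_eq_hull hm hφ.mono hφ.map_zero] at hx
  obtain ⟨A, xs, hA, hxs, hAx, hAρ⟩ := stableExt_spec (f := ρ) hm hx
  rw [← AEEqFun.coeFn_le]
  refine hA.ae_of_forall fun k => ?_
  have hle : ∀ᵐ ω ∂μ, ω ∈ A k → toE (ρ (xs k)) ω ≤ esssup C ω := by
    rw [hrep (xs k) (hxs k)]
    refine esssup_le_on (hm _ (hA.1 k)) _ ?_
    rintro _ ⟨y, hy, hy1, hy0, rfl⟩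
    have hyC : subE (condEExt m μ (x * y)) (fenchelModule m φ (extension m φ ρ) y) ∈ C := by
      refine ⟨y, ?_, ?_, hy0, rfl⟩
      · rw [orliczModule_eq_hull hm (conj_mono φ) (conj_zero φ)]
        exact subset_hull _ hy
      · rw [condEExt_eq hm (integrable_of_mem_orlicz_conj hφ hy), hy1]
    have hE := condEExt_eq_on hm (mul_mem_hull hφ.mono hx (subset_hull _ hy))
      (integrable_coeFn_mul hφ.mono (hxs k) hy) (hA.1 k) (by
        filter_upwards [hAx k, AEEqFun.coeFn_mul x y, AEEqFun.coeFn_mul (xs k) y]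
          with ω h1 h2 h3 hω
        rw [h2, h3, Pi.mul_apply, Pi.mul_apply, h1 hω])
    filter_upwards [hE, AEEqFun.coeFn_le.2 ((isLUB_esssup C).1 hyC),
      AEEqFun.coeFn_le.2 (fenchelModule_extension_le_fenchel hm hφ hy),
      coeFn_subE (condEExt m μ (x * y)) (fenchelModule m φ (extension m φ ρ) y),
      coeFn_subE (condE m μ (xs k * y)) (fenchel m φ ρ y)] with ω h1 h2 h3 h4 h5 hω
    refine le_trans ?_ h2
    rw [h4, h5, h1 hω]
    exact EReal.sub_le_sub le_rfl h3
  filter_upwards [hle, hAρ k, coeFn_toE (ρ (xs k)), coeFn_toE (extension m φ ρ x)]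
    with ω h1 h2 h3 h4 hω
  have h5 := h1 hω
  rw [h3] at h5
  rw [h4]
  change ((stableExt m (orlicz m0 μ φ) ρ x ω : ℝ) : EReal) ≤ _
  rwa [h2 hω]

/-- The modular conjugate has an `m`-measurable version, which nowhere takes the value `-∞`. -/
theorem exists_measurable_fenchelModule (hm : m ≤ m0) [IsFiniteMeasure μ] (hφ : IsYoung φ)
    (hρ : IsCondConvexRiskMeasure m μ φ ψ ρ) {y : Ω →ₘ[μ] ℝ}
    (hy : y ∈ hull m (orlicz m0 μ (conj φ))) :
    ∃ F : Ω → EReal, Measurable[m] F ∧ (∀ ω, F ω ≠ ⊥) ∧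
      ∀ᵐ ω ∂μ, fenchelModule m φ (extension m φ ρ) y ω = F ω := by
  have hE := orliczModule_eq_hull (m := m) (μ := μ) hm hφ.mono hφ.map_zero
  have hne : {g : Ω →ₘ[μ] EReal | ∃ x ∈ orliczModule m μ φ,
      g = toE (condEExt m μ (x * y) - extension m φ ρ x)}.Nonempty := by
    refine ⟨_, 1, ?_, rfl⟩
    rw [hE]
    exact subset_hull _ (one_mem_orlicz hφ.mono hφ.exists_pos_lt_top)
  obtain ⟨t, ht⟩ := exists_seq_esssup hne
  choose x hx hxt using fun n => (t n).2
  rw [hE] at hx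
  choose f hf hxf using fun n =>
    condEExt_mem_L0 hm (mul_mem_hull hφ.mono (hx n) hy)
  choose g hg hxg using fun n =>
    stableExt_mem_L0 (f := ρ) hm (fun x hx => hρ.mem_L0 hx) (hx n)
  refine ⟨fun ω => ⨆ n, ((f n ω - g n ω : ℝ) : EReal), ?_, fun ω h => ?_, ?_⟩
  · exact @Measurable.iSup _ _ _ _ _ m _ _ _ _ _ _ fun n =>
      measurable_coe_real_ereal.comp ((hf n).sub (hg n)).measurable
  · have := iSup_eq_bot.1 h 0
    exact EReal.coe_ne_bot _ this
  · filter_upwards [ht, ae_all_iff.2 hxf, ae_all_iff.2 hxg,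
      ae_all_iff.2 fun n => coeFn_toE (condEExt m μ (x n * y) - extension m φ ρ (x n)),
      ae_all_iff.2 fun n => AEEqFun.coeFn_sub (condEExt m μ (x n * y)) (extension m φ ρ (x n))]
      with ω h1 h2 h3 h4 h5
    refine h1.trans (iSup_congr fun n => ?_)
    rw [hxt n, h4 n, h5 n, Pi.sub_apply, h2 n]
    change ((_ - stableExt m (orlicz m0 μ φ) ρ (x n) ω : ℝ) : EReal) = _
    rw [h3 n]

/-- The dual representation of the stable extension implies its lower semicontinuity. -/
theorem weakLSC_of_extension_representation (hm : m ≤ m0) [IsFiniteMeasure μ] (hφ : IsYoung φ)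
    (hρ : IsCondConvexRiskMeasure m μ φ ψ ρ)
    (hrep : ∀ x ∈ orliczModule m μ φ, toE (extension m φ ρ x) =
      esssup {g | ∃ y ∈ orliczModule m μ (conj φ), condEExt m μ y = -1 ∧ y ≤ 0 ∧
        g = subE (condEExt m μ (x * y)) (fenchelModule m φ (extension m φ ρ) y)}) :
    WeakLSC m μ (orliczModule m μ φ) (orliczModule m μ (conj φ)) (extension m φ ρ) := by
  classical
  intro c hc
  have hE := orliczModule_eq_hull (m := m) (μ := μ) hm hφ.mono hφ.map_zero
  have hG := orliczModule_eq_hull (m := m) (μ := μ) hm (conj_mono φ) (conj_zero φ)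
  refine @IsClosed.mk _ (weakTopology m μ _ _) _ ?_
  rintro ⟨x, hx⟩ hxc
  have hxc' : ¬ toE (extension m φ ρ x) ≤ toE c := fun h => hxc (toE_le_toE.1 h)
  rw [hrep x hx] at hxc'
  -- Only the violation of the level by `y` matters from here on; its sign and normalisation are
  -- discarded.
  obtain ⟨y, hy, hyc⟩ : ∃ y ∈ orliczModule m μ (conj φ),
      ¬ subE (condEExt m μ (x * y)) (fenchelModule m φ (extension m φ ρ) y) ≤ toE c := by
    by_contra! h
    refine hxc' ((isLUB_esssup _).2 ?_)
    rintro _ ⟨y, hy, -, -, rfl⟩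
    exact h y hy
  have hx' := hE ▸ hx
  have hy' := hG ▸ hy
  obtain ⟨F, hFm, hFbot, hF⟩ := exists_measurable_fenchelModule hm hφ hρ hy'
  obtain ⟨a, ha, hxa⟩ := condEExt_mem_L0 hm (mul_mem_hull hφ.mono hx' hy')
  obtain ⟨c', hc', hcc'⟩ := hc
  let B : Set Ω := {ω | (c' ω : EReal) < (a ω : EReal) - F ω}
  have hBm : MeasurableSet[m] B := by
    have h1 : Measurable[m] fun ω => (c' ω : EReal) := measurable_coe_real_ereal.comp hc'.measurable
    have h2 : Measurable[m] fun ω => (a ω : EReal) - F ω := measurable_ereal_sub.comp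
      ((measurable_coe_real_ereal.comp ha.measurable).prodMk hFm)
    exact (h1.prodMk h2) measurableSet_lt'
  have hB : μ B ≠ 0 := by
    intro h0
    apply hyc
    rw [← AEEqFun.coeFn_le]
    filter_upwards [measure_eq_zero_iff_ae_notMem.1 h0, hF, hxa, hcc', coeFn_toE c,
      coeFn_subE (condEExt m μ (x * y)) (fenchelModule m φ (extension m φ ρ) y)]
      with ω h1 h2 h3 h4 h5 h6
    rw [h5, h6, h2, h3, h4]
    exact not_lt.1 h1
  -- The radius is half the gap on `B`, where the conjugate is finite, and an arbitrary positive
  -- value elsewhere. A point `z` of the neighbourhood with `ρ̄(z) ≤ c` would make the gap at most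
  -- half of itself on `B`.
  let e : Ω → ℝ := B.piecewise (fun ω => (a ω - (F ω).toReal - c' ω) / 2) fun _ => 1
  have hem : StronglyMeasurable[m] e := by
    have h1 : Measurable[m] fun ω => (F ω).toReal := measurable_ereal_toReal.comp hFm
    refine StronglyMeasurable.piecewise hBm ?_ (@stronglyMeasurable_const _ _ m _ _)
    exact (((ha.sub (Measurable.stronglyMeasurable h1)).sub
      hc').measurable.div_const 2).stronglyMeasurable
  have hFtop : ∀ ω ∈ B, ((F ω).toReal : EReal) = F ω := by
    intro ω hω
    refine EReal.coe_toReal (fun h => ?_) (hFbot ω)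
    have : (c' ω : EReal) < (a ω : EReal) - F ω := hω
    rw [h, EReal.sub_top] at this
    exact not_lt_bot this
  have hBpos : ∀ ω ∈ B, 0 < a ω - (F ω).toReal - c' ω := by
    intro ω hω
    have : (c' ω : EReal) < (a ω : EReal) - F ω := hω
    rw [← hFtop ω hω, ← EReal.coe_sub, EReal.coe_lt_coe_iff] at this
    linarith
  obtain ⟨ε, hε, hεe⟩ := exists_class_of_stronglyMeasurable (μ := μ) hm hem
  refine ⟨{y}, by simpa using hy, ε, ⟨hε, ?_⟩, fun z hz hzc => ?_⟩
  · filter_upwards [hεe] with ω h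
    rw [h]
    by_cases hω : ω ∈ B
    · simp only [e, piecewise_eq_of_mem _ _ _ hω]
      exact half_pos (hBpos ω hω)
    · simp only [e, piecewise_eq_of_notMem _ _ _ hω]
      exact one_pos
  · apply hB
    rw [measure_eq_zero_iff_ae_notMem]
    have hz' : z.1 ∈ hull m (orlicz m0 μ φ) := hE ▸ z.2
    have hmul : (z.1 - x) * y = z.1 * y - x * y := by
      refine AEEqFun.ext ?_
      filter_upwards [AEEqFun.coeFn_mul (z.1 - x) y, AEEqFun.coeFn_sub z.1 x,
        AEEqFun.coeFn_mul z.1 y, AEEqFun.coeFn_mul x y, AEEqFun.coeFn_sub (z.1 * y) (x * y)]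
        with ω h1 h2 h3 h4 h5
      rw [h1, h5, Pi.mul_apply, h2, Pi.sub_apply, Pi.sub_apply, h3, h4, Pi.mul_apply, Pi.mul_apply,
        sub_mul]
    filter_upwards [hz y (by simp), condEExt_sub hm (mul_mem_hull hφ.mono hz' hy')
      (mul_mem_hull hφ.mono hx' hy'), coe_sub_le_fenchelModule (f := extension m φ ρ) z.2 y,
      AEEqFun.coeFn_le.2 hzc, hF, hxa, hcc', hεe] with ω h1 h2 h3 h4 h5 h6 h7 h8 hω
    rw [hmul, h2, h6, h8] at h1
    simp only [e, piecewise_eq_of_mem _ _ _ hω] at h1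
    rw [h5, ← hFtop ω hω, EReal.coe_le_coe_iff] at h3
    rw [h7] at h4
    have h9 := hBpos ω hω
    have h10 := (abs_le.1 h1).1
    linarith

end Duality

end CondRisk

end

theorem theorem5p7 {Ω : Type*} {m m0 : MeasurableSpace Ω} (hm : m ≤ m0) (μ : Measure[m0] Ω)
    [IsProbabilityMeasure μ] (φ ψ : ℝ≥0 → ℝ≥0∞) (hφ : CondRisk.IsYoung φ)
    (hψ : CondRisk.IsYoung ψ) (hψφ : ∀ t, ψ t ≤ φ t) (ρ : (Ω →ₘ[μ] ℝ) → (Ω →ₘ[μ] ℝ))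
    (hρ : CondRisk.IsCondConvexRiskMeasure m μ φ ψ ρ) :
    List.TFAE [
      CondRisk.WeakLSC m μ (CondRisk.orliczModule m μ φ)
        (CondRisk.orliczModule m μ (CondRisk.conj φ)) (CondRisk.extension m φ ρ),
      ∀ x ∈ CondRisk.orliczModule m μ φ,
        CondRisk.toE (CondRisk.extension m φ ρ x) =
          CondRisk.esssup {g | ∃ y ∈ CondRisk.orliczModule m μ (CondRisk.conj φ),
            CondRisk.condEExt m μ y = -1 ∧ y ≤ 0 ∧
            g = CondRisk.subE (CondRisk.condEExt m μ (x * y))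
              (CondRisk.fenchelModule m φ (CondRisk.extension m φ ρ) y)},
      ∀ x ∈ CondRisk.orlicz m0 μ φ,
        CondRisk.toE (ρ x) =
          CondRisk.esssup {g | ∃ y ∈ CondRisk.orlicz m0 μ (CondRisk.conj φ),
            CondRisk.condE m μ y = -1 ∧ y ≤ 0 ∧
            g = CondRisk.subE (CondRisk.condE m μ (x * y)) (CondRisk.fenchel m φ ρ y)}] := by
  tfae_have 1 → 3 := fun h _ hx => CondRisk.representation_of_weakLSC hm hφ hρ h hx
  tfae_have 3 → 2 := fun h _ hx => CondRisk.extension_representation hm hφ h hx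
  tfae_have 2 → 1 := CondRisk.weakLSC_of_extension_representation hm hφ hρ
  tfae_finish
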